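/- Let $\mathbb{E}^4_2$ be $\mathbb{R}^4$ with the scalar product $\langle v,w\rangle=-v_1w_1-v_2w_2+v_3w_3+v_4w_4$, and let $\mathbb{H}^3_1=\{x\in\mathbb{E}^4_2:\langle x,x\rangle=-1\}$ be the anti-de Sitter space. **B-scrolls.** Let $\gamma:I\to\mathbb{H}^3_1$ be a smooth null curve on a non-empty open interval $I$, with a smooth Cartan frame field $(A,B,C)$, that is, $A,B,C$ are tangent to $\mathbb{H}^3_1$ along $\gamma$, $\langle A,A\rangle=\langle B,B\rangle=\langle A,C\rangle=\langle B,C\rangle=0$, $\langle A,B\rangle=-1$, $\langle C,C\rangle=1$, and $$\dot\gamma=A,\qquad \dot A=k_1C,\qquad \dot C=k_2A+k_1B,\qquad \dot B=k_2C-\gamma,$$ where $k_1>0$ is a function on $I$ and $k_2\neq 0$ is a constant. The immersed Lorentzian surface ${\bf x}:I\times\mathbb{R}\to\mathbb{H}^3_1$, ${\bf x}(s,t)=\gamma(s)+tB(s)$, considered up to diffeomorphisms of the parameter domain, is called a B-scroll. **Parallel surfaces.** If $N$ is a smooth unit normal field of ${\bf x}$ in $\mathbb{H}^3_1$, the parallel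 surface $M_u$ at distance $u\in\mathbb{R}$ is ${\bf x}^u(p)=\exp_{{\bf x}(p)}(uN_p)=\cosh u\,{\bf x}(p)+\sinh u\,N_p$, $p\in I\times\mathbb{R}$. **Type number.** For a Lorentzian surface ${\bf x}:U\to\mathbb{H}^3_1$ on an open set $U\subset\mathbb{R}^2$ with its coordinate orientation, the pseudo-hyperbolic Gauss map is $\tilde\nu={\bf x}\wedge e_1\wedge e_2:U\to\bigwedge^3\mathbb{E}^4_2$, where $(e_1,e_2)$ is any positively oriented orthonormal frame of the tangent plane. A smooth map $\phi$ from $U$ to a finite-dimensional real vector space is of $k$-type ($k\ge 1$) if $\phi=\phi_1+\dots+\phi_k$ with non-constant smooth maps $\phi_i$ such that $\Delta\phi_i=\lambda_i\phi_i$ for pairwise distinct real numbers $\lambda_i$, where $\Delta$ is the Laplacian of the induced metric; it is of null $k$-type if moreover some $\lambda_i$ is $0$. The type number of $\phi$ is this $k$, and $\infty$ if there is none. **Theorem.** Let $M$ be a B-scroll ${\bf x}(s,t)=\gamma(s)+tB(s)$, $(s,t)\in I\times\mathbb{R}$, in $\mathbb{H}^3_1$ with second curvature $k_2$, and let $N$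 be a smooth unit normal field of $M$. 1. There is $\delta>0$ such that for all $u$ with $|u|<\delta$: * ${\bf x}^u:I\times\mathbb{R}\to\mathbb{H}^3_1$ is a Lorentzian immersion; * $M_u$ is locally a B-scroll: each $s\in I$ lies in an open interval $J\subset I$ such that ${\bf x}^u|_{J\times\mathbb{R}}$ is a B-scroll, with a second curvature of the same sign as $k_2$; * $M_u$ is flat if and only if $M$ is flat; * the pseudo-hyperbolic Gauss maps of $M_u$ and of $M$ have the same type number, and for every $k$ the one is of $k$-type (of null $k$-type) if and only if the other is. 2. For every compact $K\subset I$ there is $\varepsilon>0$ such that for all $u$ with $|u|<\varepsilon$ there is an open interval $J$ with $K\subset J\subset I$ for which ${\bf x}^u|_{J\times\mathbb{R}}$ is a B-scroll, with a second curvature of the same sign as $k_2$. -/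

import Mathlib

open scoped ContDiff

noncomputable section

namespace AdS

/-! ### The pseudo-Euclidean space of dimension 4 and index 2, and anti-de Sitter space -/

/-- The vector space underlying the pseudo-Euclidean space of dimension 4 and index 2. -/
abbrev E42 : Type := Fin 4 → ℝ

/-- The scalar product of signature `(-,-,+,+)`. -/
def ip (v w : E42) : ℝ := -(v 0 * w 0) - v 1 * w 1 + v 2 * w 2 + v 3 * w 3

/-- The anti-de Sitter space of dimension 3, as the hyperquadric `⟨x, x⟩ = -1`. -/
def H31 : Set E42 := {x | ip x x = -1}

/-! ### Parametrized surfaces; the induced metric and its Levi-Civita calculus -/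

/-- The coordinate directions of the `(s,t)`-plane. -/
def dir : Fin 2 → ℝ × ℝ := ![(1, 0), (0, 1)]

/-- The partial derivative in the `i`-th coordinate direction. -/
def pd {F : Type*} [NormedAddCommGroup F] [NormedSpace ℝ F] (i : Fin 2) (f : ℝ × ℝ → F)
    (p : ℝ × ℝ) : F :=
  fderiv ℝ f p (dir i)

/-- The metric induced by `x`, in the coordinates `(s,t)`. -/
def metric (x : ℝ × ℝ → E42) (p : ℝ × ℝ) : Matrix (Fin 2) (Fin 2) ℝ :=
  Matrix.of fun i j => ip (pd i x p) (pd j x p)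

/-- `x` restricted to the open set `U` is a smooth Lorentzian immersion into anti-de Sitter
space: a symmetric `2 × 2` matrix has signature `(-,+)` iff its determinant is negative, and then
the two partial derivatives of `x` are linearly independent. -/
structure IsLorentzSurface (x : ℝ × ℝ → E42) (U : Set (ℝ × ℝ)) : Prop where
  smooth : ContDiffOn ℝ ∞ x U
  mem : ∀ p ∈ U, x p ∈ H31
  lorentz : ∀ p ∈ U, (metric x p).det < 0

/-- The Christoffel symbol `Γ^k_{ij}` of the metric `g`. -/
def christoffel (g : ℝ × ℝ → Matrix (Fin 2) (Fin 2) ℝ) (k i j : Fin 2) (p : ℝ × ℝ) : ℝ :=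
  (1 / 2) * ∑ l, (g p)⁻¹ k l *
    (pd i (fun q => g q j l) p + pd j (fun q => g q i l) p - pd l (fun q => g q i j) p)

/-- The component `R^l_{kij}` of the Riemann curvature tensor of the metric `g`, that is,
`R(∂_i, ∂_j) ∂_k = ∑ l, R^l_{kij} ∂_l`. -/
def riemann (g : ℝ × ℝ → Matrix (Fin 2) (Fin 2) ℝ) (l k i j : Fin 2) (p : ℝ × ℝ) : ℝ :=
  pd i (christoffel g l j k) p - pd j (christoffel g l i k) p
    + ∑ m, (christoffel g l i m p * christoffel g m j k p
        - christoffel g l j m p * christoffel g m i k p)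

/-- The surface `x` on `U` is flat: the curvature of its induced metric vanishes identically. -/
def IsFlat (x : ℝ × ℝ → E42) (U : Set (ℝ × ℝ)) : Prop :=
  ∀ p ∈ U, ∀ l k i j : Fin 2, riemann (metric x) l k i j p = 0

/-- The Laplacian of the metric `g` (minus the trace of the Hessian). -/
def laplacian (g : ℝ × ℝ → Matrix (Fin 2) (Fin 2) ℝ) (f : ℝ × ℝ → ℝ) (p : ℝ × ℝ) : ℝ :=
  -∑ i, ∑ j, (g p)⁻¹ i j * (pd i (pd j f) p - ∑ k, christoffel g k i j p * pd k f p)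

/-! ### Maps of finite type -/

/-- `ψ` is a smooth map on `U` with values in the finite-dimensional space `W` such that
`Δ ψ = μ ψ`. Smoothness and the equation are expressed through the linear coordinates on `W`. -/
def IsEigenmap {W : Type*} [AddCommGroup W] [Module ℝ W]
    (g : ℝ × ℝ → Matrix (Fin 2) (Fin 2) ℝ) (U : Set (ℝ × ℝ)) (μ : ℝ) (ψ : ℝ × ℝ → W) : Prop :=
  ∀ ℓ : Module.Dual ℝ W, ContDiffOn ℝ ∞ (fun p => ℓ (ψ p)) U ∧
    ∀ p ∈ U, laplacian g (fun q => ℓ (ψ q)) p = μ * ℓ (ψ p)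

/-- `φ = ψ 0 + ... + ψ (k-1)` on `U`, where the `ψ i` are non-constant eigenmaps of the Laplacian
for the pairwise distinct real eigenvalues `μ i`. -/
structure IsSpectralDecomposition {W : Type*} [AddCommGroup W] [Module ℝ W]
    (g : ℝ × ℝ → Matrix (Fin 2) (Fin 2) ℝ) (U : Set (ℝ × ℝ)) (φ : ℝ × ℝ → W) {k : ℕ}
    (μ : Fin k → ℝ) (ψ : Fin k → ℝ × ℝ → W) : Prop where
  distinct : Function.Injective μ
  nonconst : ∀ i, ∃ p ∈ U, ∃ q ∈ U, ψ i p ≠ ψ i q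
  eigen : ∀ i, IsEigenmap g U (μ i) (ψ i)
  sum_eq : ∀ p ∈ U, φ p = ∑ i, ψ i p

/-- `φ` is of `k`-type. -/
def IsKType {W : Type*} [AddCommGroup W] [Module ℝ W]
    (g : ℝ × ℝ → Matrix (Fin 2) (Fin 2) ℝ) (U : Set (ℝ × ℝ)) (k : ℕ) (φ : ℝ × ℝ → W) : Prop :=
  1 ≤ k ∧ ∃ (μ : Fin k → ℝ) (ψ : Fin k → ℝ × ℝ → W), IsSpectralDecomposition g U φ μ ψ

/-- `φ` is of null `k`-type: of `k`-type, with zero among the eigenvalues. -/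
def IsNullKType {W : Type*} [AddCommGroup W] [Module ℝ W]
    (g : ℝ × ℝ → Matrix (Fin 2) (Fin 2) ℝ) (U : Set (ℝ × ℝ)) (k : ℕ) (φ : ℝ × ℝ → W) : Prop :=
  1 ≤ k ∧ ∃ (μ : Fin k → ℝ) (ψ : Fin k → ℝ × ℝ → W),
    IsSpectralDecomposition g U φ μ ψ ∧ ∃ i, μ i = 0

/-- The type number: the `k` for which `φ` is of `k`-type, and `⊤` if `φ` is of infinite type. -/
def typeNumber {W : Type*} [AddCommGroup W] [Module ℝ W]
    (g : ℝ × ℝ → Matrix (Fin 2) (Fin 2) ℝ) (U : Set (ℝ × ℝ)) (φ : ℝ × ℝ → W) : ℕ∞ :=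
  ⨅ (k : ℕ) (_ : IsKType g U k φ), (k : ℕ∞)

/-! ### The pseudo-hyperbolic Gauss map -/

/-- The pseudo-hyperbolic Gauss map of the surface `x`, oriented by the coordinates `(s,t)`, with
values in the third exterior power. It equals `x ∧ e₁ ∧ e₂` for each positively oriented
orthonormal frame `(e₁, e₂)` of the tangent plane: see `gaussMap_eq_wedge`. -/
def gaussMap (x : ℝ × ℝ → E42) (p : ℝ × ℝ) : ⋀[ℝ]^3 E42 :=
  (√|(metric x p).det|)⁻¹ • exteriorPower.ιMulti ℝ 3 ![x p, pd 0 x p, pd 1 x p]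

theorem ip_comb (a b c d : ℝ) (v w : E42) :
    ip (a • v + b • w) (c • v + d • w)
      = a * c * ip v v + a * d * ip v w + b * c * ip w v + b * d * ip w w := by
  simp only [ip, Pi.add_apply, Pi.smul_apply, smul_eq_mul]; ring

theorem gaussMap_eq_wedge (x : ℝ × ℝ → E42) (p : ℝ × ℝ) (a b c d : ℝ) (hpos : 0 < a * d - b * c)
    (e₁ e₂ : E42) (he₁ : e₁ = a • pd 0 x p + b • pd 1 x p) (he₂ : e₂ = c • pd 0 x p + d • pd 1 x p)
    (h₁₁ : |ip e₁ e₁| = 1) (h₂₂ : |ip e₂ e₂| = 1) (h₁₂ : ip e₁ e₂ = 0) :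
    gaussMap x p = exteriorPower.ιMulti ℝ 3 ![x p, e₁, e₂] := by
  have hdet : (metric x p).det * (a * d - b * c) ^ 2 = ip e₁ e₁ * ip e₂ e₂ := by
    have h : (metric x p).det * (a * d - b * c) ^ 2
        = ip e₁ e₁ * ip e₂ e₂ - ip e₁ e₂ * ip e₁ e₂ := by
      rw [he₁, he₂, ip_comb, ip_comb, ip_comb, Matrix.det_fin_two]
      simp only [metric, Matrix.of_apply]
      rw [show ip (pd 1 x p) (pd 0 x p) = ip (pd 0 x p) (pd 1 x p) by simp only [ip]; ring]
      ring
    rw [h, h₁₂]; ring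
  have habs : |(metric x p).det| * (a * d - b * c) ^ 2 = 1 := by
    have h := congrArg abs hdet
    rwa [abs_mul, abs_mul, h₁₁, h₂₂, abs_of_pos (pow_pos hpos 2), one_mul] at h
  have hsqrt : (√|(metric x p).det|)⁻¹ = a * d - b * c := by
    have h : √|(metric x p).det| * (a * d - b * c) = 1 := by
      rw [← Real.sqrt_one, ← habs, Real.sqrt_mul (abs_nonneg _), Real.sqrt_sq hpos.le]
    exact inv_eq_of_mul_eq_one_right h
  have hw : ∀ f : E42 [⋀^Fin 3]→ₗ[ℝ] (⋀[ℝ]^3 E42), ∀ z v w : E42,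
      f ![z, a • v + b • w, c • v + d • w] = (a * d - b * c) • f ![z, v, w] := by
    intro f z v w
    have upd₁ : ∀ y y' : E42, ![z, y, y'] = Function.update ![z, 0, y'] 1 y := by
      intro y y'; ext i : 1; fin_cases i <;> rfl
    have upd₂ : ∀ y y' : E42, ![z, y, y'] = Function.update ![z, y, 0] 2 y' := by
      intro y y'; ext i : 1; fin_cases i <;> rfl
    have lin₁ : ∀ (r t : ℝ) (y₁ y₂ y' : E42), f ![z, r • y₁ + t • y₂, y']
        = r • f ![z, y₁, y'] + t • f ![z, y₂, y'] := by
      intro r t y₁ y₂ y'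
      rw [upd₁ (r • y₁ + t • y₂), upd₁ y₁, upd₁ y₂, f.map_update_add, f.map_update_smul,
        f.map_update_smul]
    have lin₂ : ∀ (r t : ℝ) (y y₁ y₂ : E42), f ![z, y, r • y₁ + t • y₂]
        = r • f ![z, y, y₁] + t • f ![z, y, y₂] := by
      intro r t y y₁ y₂
      rw [upd₂ y (r • y₁ + t • y₂), upd₂ y y₁, upd₂ y y₂, f.map_update_add, f.map_update_smul,
        f.map_update_smul]
    have alt : ∀ y : E42, f ![z, y, y] = 0 := fun y =>
      f.map_eq_zero_of_eq _ (i := 1) (j := 2) rfl (by decide)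
    have swap : f ![z, w, v] = -f ![z, v, w] := by
      have h := alt ((1 : ℝ) • v + (1 : ℝ) • w)
      rw [lin₁, lin₂, lin₂, alt, alt] at h
      simp only [one_smul, zero_add, add_zero] at h
      exact eq_neg_of_add_eq_zero_right h
    rw [lin₁, lin₂, lin₂, alt, alt, swap]
    module
  rw [gaussMap, hsqrt, he₁, he₂, hw]

/-- The type number of the pseudo-hyperbolic Gauss map of the surface `x` on `U`. -/
def gaussTypeNumber (x : ℝ × ℝ → E42) (U : Set (ℝ × ℝ)) : ℕ∞ :=
  typeNumber (metric x) U (gaussMap x)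

/-- The pseudo-hyperbolic Gauss map of the surface `x` on `U` is of `k`-type. -/
def GaussIsKType (x : ℝ × ℝ → E42) (U : Set (ℝ × ℝ)) (k : ℕ) : Prop :=
  IsKType (metric x) U k (gaussMap x)

/-- The pseudo-hyperbolic Gauss map of the surface `x` on `U` is of null `k`-type. -/
def GaussIsNullKType (x : ℝ × ℝ → E42) (U : Set (ℝ × ℝ)) (k : ℕ) : Prop :=
  IsNullKType (metric x) U k (gaussMap x)

/-! ### Parallel surfaces -/

/-- `N` is a smooth unit normal field, in anti-de Sitter space, of the Lorentzian surface `x` on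
`U`; the normal of a Lorentzian surface there is spacelike. -/
structure IsUnitNormal (x N : ℝ × ℝ → E42) (U : Set (ℝ × ℝ)) : Prop where
  smooth : ContDiffOn ℝ ∞ N U
  tangent : ∀ p ∈ U, ip (N p) (x p) = 0
  normal : ∀ p ∈ U, ∀ i : Fin 2, ip (N p) (pd i x p) = 0
  unit : ∀ p ∈ U, ip (N p) (N p) = 1

/-- Geodesics of anti-de Sitter space: the tangential part of the acceleration vanishes. -/
structure IsGeodesic (c : ℝ → E42) : Prop where
  smooth : ContDiff ℝ ∞ c
  mem : ∀ τ, c τ ∈ H31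
  acc : ∀ τ, ∀ v : E42, ip v (c τ) = 0 → ip (deriv (deriv c) τ) v = 0

/-- The parallel surface at distance `u`, that is `p ↦ exp_{x p} (u N p)`: see
`isGeodesic_iff` for the geodesics of anti-de Sitter space with a spacelike unit velocity. -/
def parallel (x N : ℝ × ℝ → E42) (u : ℝ) (p : ℝ × ℝ) : E42 :=
  Real.cosh u • x p + Real.sinh u • N p

theorem isGeodesic_iff (c : ℝ → E42) (q v : E42) (hq : q ∈ H31) (hqv : ip v q = 0)
    (hv : ip v v = 1) :
    (IsGeodesic c ∧ c 0 = q ∧ deriv c 0 = v) ↔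
      c = fun u => Real.cosh u • q + Real.sinh u • v := by
  have ip_comm : ∀ a b : E42, ip a b = ip b a := fun a b => by simp only [ip]; ring
  have hq' : ip q q = -1 := hq
  constructor
  · rintro ⟨⟨hs, hm, ha⟩, h0, h1⟩
    have hd1 : ∀ τ, HasDerivAt c (deriv c τ) τ := fun τ =>
      (hs.differentiable (by simp)).differentiableAt.hasDerivAt
    have hs' : ContDiff ℝ ∞ (deriv c) := (contDiff_infty_iff_deriv.1 hs).2
    have hd2 : ∀ τ, HasDerivAt (deriv c) (deriv (deriv c) τ) τ := fun τ =>
      (hs'.differentiable (by simp)).differentiableAt.hasDerivAt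
    have hip : ∀ (f g : ℝ → E42) (f' g' : E42) (τ : ℝ), HasDerivAt f f' τ → HasDerivAt g g' τ →
        HasDerivAt (fun t => ip (f t) (g t)) (ip f' (g τ) + ip (f τ) g') τ := by
      intro f g f' g' τ hf hg
      rw [hasDerivAt_pi] at hf hg
      have h := ((((hf 0).mul (hg 0)).neg.sub ((hf 1).mul (hg 1))).add
        ((hf 2).mul (hg 2))).add ((hf 3).mul (hg 3))
      refine HasDerivAt.congr_deriv (f := fun t => ip (f t) (g t)) h ?_
      simp only [ip]; ring
    have hcc : ∀ τ, ip (c τ) (c τ) = -1 := hm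
    have hc1 : ∀ τ, ip (deriv c τ) (c τ) = 0 := by
      intro τ
      have h := (hip c c _ _ τ (hd1 τ) (hd1 τ)).unique
        ((hasDerivAt_const τ (-1 : ℝ)).congr_of_eventuallyEq (.of_forall hcc))
      rw [ip_comm (c τ)] at h
      linarith
    have hc2 : ∀ τ, ip (deriv (deriv c) τ) (deriv c τ) = 0 := fun τ => ha τ _ (hc1 τ)
    have hspeed : ∀ τ, ip (deriv c τ) (deriv c τ) = 1 := by
      intro τ
      have hder : ∀ t, HasDerivAt (fun t => ip (deriv c t) (deriv c t)) 0 t := by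
        intro t
        have h := hip _ _ _ _ t (hd2 t) (hd2 t)
        rw [ip_comm (deriv c t), hc2 t, add_zero] at h
        exact h
      have h := is_const_of_deriv_eq_zero (fun t => (hder t).differentiableAt)
        (fun t => (hder t).deriv) τ 0
      simp only [h1, hv] at h
      exact h
    have hc3 : ∀ τ, ip (deriv (deriv c) τ) (c τ) = -1 := by
      intro τ
      have h := (hip _ _ _ _ τ (hd2 τ) (hd1 τ)).unique
        ((hasDerivAt_const τ (0 : ℝ)).congr_of_eventuallyEq (.of_forall hc1))
      rw [hspeed τ] at h
      linarith
    have hode : ∀ τ, deriv (deriv c) τ = c τ := by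
      intro τ
      have key : ∀ w : E42, ip (deriv (deriv c) τ) w = ip (c τ) w := by
        intro w
        have h := ha τ (w + ip (c τ) w • c τ) (by
          have := hcc τ
          have e : ip (w + ip (c τ) w • c τ) (c τ)
              = ip (c τ) w + ip (c τ) w * ip (c τ) (c τ) := by
            simp only [ip, Pi.add_apply, Pi.smul_apply, smul_eq_mul]; ring
          rw [e, this]; ring)
        have e : ip (deriv (deriv c) τ) (w + ip (c τ) w • c τ)
            = ip (deriv (deriv c) τ) w + ip (c τ) w * ip (deriv (deriv c) τ) (c τ) := by
          simp only [ip, Pi.add_apply, Pi.smul_apply, smul_eq_mul]; ring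
        rw [e, hc3 τ] at h
        linarith
      ext i
      have h := key (Pi.single i 1)
      fin_cases i <;> simpa [ip] using h
    have hplus : ∀ τ, Real.exp (-τ) • (c τ + deriv c τ) = q + v := by
      intro τ
      have hder : ∀ t, HasDerivAt (fun t => Real.exp (-t) • (c t + deriv c t)) 0 t := by
        intro t
        have h := ((hasDerivAt_neg t).exp).smul ((hd1 t).add (hd2 t))
        refine HasDerivAt.congr_deriv (f := fun t => Real.exp (-t) • (c t + deriv c t)) h ?_
        rw [hode t, Pi.add_apply]
        module
      have h := is_const_of_deriv_eq_zero (fun t => (hder t).differentiableAt)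
        (fun t => (hder t).deriv) τ 0
      simpa [h0, h1] using h
    have hminus : ∀ τ, Real.exp τ • (c τ - deriv c τ) = q - v := by
      intro τ
      have hder : ∀ t, HasDerivAt (fun t => Real.exp t • (c t - deriv c t)) 0 t := by
        intro t
        have h := (Real.hasDerivAt_exp t).smul ((hd1 t).sub (hd2 t))
        refine HasDerivAt.congr_deriv (f := fun t => Real.exp t • (c t - deriv c t)) h ?_
        rw [hode t, Pi.sub_apply]
        module
      have h := is_const_of_deriv_eq_zero (fun t => (hder t).differentiableAt)
        (fun t => (hder t).deriv) τ 0
      simpa [h0, h1] using h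
    funext τ
    have e1 : c τ + deriv c τ = Real.exp τ • (q + v) := by
      rw [← hplus τ, smul_smul, ← Real.exp_add]; simp
    have e2 : c τ - deriv c τ = Real.exp (-τ) • (q - v) := by
      rw [← hminus τ, smul_smul, ← Real.exp_add]; simp
    have e3 : c τ = (1 / 2 : ℝ) • ((c τ + deriv c τ) + (c τ - deriv c τ)) := by module
    rw [e3, e1, e2, Real.cosh_eq, Real.sinh_eq]
    module
  · rintro rfl
    have hd : ∀ a b : E42, ∀ τ, HasDerivAt (fun u => Real.cosh u • a + Real.sinh u • b)
        (Real.cosh τ • b + Real.sinh τ • a) τ := by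
      intro a b τ
      have h := ((Real.hasDerivAt_cosh τ).smul_const a).add ((Real.hasDerivAt_sinh τ).smul_const b)
      exact h.congr_deriv (add_comm _ _)
    have hd1 : deriv (fun u => Real.cosh u • q + Real.sinh u • v)
        = fun u => Real.cosh u • v + Real.sinh u • q := funext fun τ => (hd q v τ).deriv
    refine ⟨⟨?_, ?_, ?_⟩, by simp, by rw [hd1]; simp⟩
    · exact (Real.contDiff_cosh.smul contDiff_const).add (Real.contDiff_sinh.smul contDiff_const)
    · intro τ
      have h := Real.cosh_sq τ
      simp only [H31, Set.mem_ofPred_eq, ip_comb, hq', hv, hqv, ip_comm q v]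
      nlinarith
    · intro τ w hw
      rw [hd1, (hd v q τ).deriv, ip_comm]
      exact hw

/-! ### B-scrolls -/

/-- `(A, B, C)` is the Cartan frame field along the null curve `γ` defined on the open interval
`I`, with first curvature `k₁ > 0` and constant second curvature `k₂`. -/
structure IsCartanFrame (I : Set ℝ) (γ A B C : ℝ → E42) (k₁ : ℝ → ℝ) (k₂ : ℝ) : Prop where
  isOpen : IsOpen I
  nonempty : I.Nonempty
  interval : I.OrdConnected
  smooth_γ : ContDiffOn ℝ ∞ γ I
  smooth_A : ContDiffOn ℝ ∞ A I
  smooth_B : ContDiffOn ℝ ∞ B I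
  smooth_C : ContDiffOn ℝ ∞ C I
  mem : ∀ s ∈ I, γ s ∈ H31
  tangent : ∀ s ∈ I, ip (A s) (γ s) = 0 ∧ ip (B s) (γ s) = 0 ∧ ip (C s) (γ s) = 0
  null : ∀ s ∈ I, ip (A s) (A s) = 0 ∧ ip (B s) (B s) = 0
  pair : ∀ s ∈ I, ip (A s) (B s) = -1
  orth : ∀ s ∈ I, ip (A s) (C s) = 0 ∧ ip (B s) (C s) = 0 ∧ ip (C s) (C s) = 1
  deriv_γ : ∀ s ∈ I, HasDerivAt γ (A s) s
  deriv_A : ∀ s ∈ I, HasDerivAt A (k₁ s • C s) s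
  deriv_C : ∀ s ∈ I, HasDerivAt C (k₂ • A s + k₁ s • B s) s
  deriv_B : ∀ s ∈ I, HasDerivAt B (k₂ • C s - γ s) s
  k₁_pos : ∀ s ∈ I, 0 < k₁ s

/-- The ruled surface `(s, t) ↦ γ s + t B s`. -/
def scroll (γ B : ℝ → E42) (p : ℝ × ℝ) : E42 := γ p.1 + p.2 • B p.1

/-- The parameter domain of a ruled surface with complete rulings over `I`. -/
def strip (I : Set ℝ) : Set (ℝ × ℝ) := I ×ˢ Set.univ

/-- `x` on `U` and `y` on `V` are the same surface up to a diffeomorphism of the parameter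
domains. -/
def SameSurface (x : ℝ × ℝ → E42) (U : Set (ℝ × ℝ)) (y : ℝ × ℝ → E42) (V : Set (ℝ × ℝ)) : Prop :=
  ∃ Φ Ψ : ℝ × ℝ → ℝ × ℝ, ContDiffOn ℝ ∞ Φ U ∧ ContDiffOn ℝ ∞ Ψ V ∧
    Set.MapsTo Φ U V ∧ Set.MapsTo Ψ V U ∧ Set.InvOn Ψ Φ U V ∧ ∀ p ∈ U, x p = y (Φ p)

/-- The surface `x` on `U` is a B-scroll, in a suitable parametrization, over a null curve whose
second curvature is the constant `k₂`. -/
def IsBScroll (x : ℝ × ℝ → E42) (U : Set (ℝ × ℝ)) (k₂ : ℝ) : Prop :=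
  ∃ (J : Set ℝ) (γ A B C : ℝ → E42) (k₁ : ℝ → ℝ), IsCartanFrame J γ A B C k₁ k₂ ∧
    SameSurface x U (scroll γ B) (strip J)

end AdS

end

/-! The unit normals of the B-scroll are `e (C + k₂ t B)` with a constant sign `e`. With `a = cosh
u`, `b = e sinh u`, `m = a + b k₂` and `n = b + a k₂`, the parallel surface is therefore `a γ + b C
+ t m B`, ruled along the same null lines, and everything follows from this formula. The original
surface is the case `(a, b) = (1, 0)`, so each property is computed once for general `(a, b)`, and
both sides of every equivalence become conditions on `k₂` alone.

B-scroll. The base curve `a γ + b C` is in general not null. Adding `f B` slides it along the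
rulings; the new curve is null exactly when `f' = c f² - b k₁` with `2 c m = k₂² - 1`. A change of
parameter then gives a Cartan frame with second curvature `n / m`, which has the sign of `k₂` for
small `u` (`isBScroll_of_riccati`). Solutions of a Riccati equation can blow up, so one interval is
obtained only locally, or over a compact set for small `u`, where the forcing term `b k₁` is small.
This accounts for the two parts of the theorem.

Flatness. The induced metric is `(α(s) + m² (k₂² - 1) t²) ds² - 2 m² ds dt`, and it is flat iff `k₂²
= 1`.

Gauss map. Let `P = γ ∧ A ∧ B`, `R = A ∧ C ∧ B`, `Q = γ ∧ C ∧ B`. The Gauss map is `G = a P - b R +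
t n Q`. The frame equations give `Q' = k₂ P + R`, whence `Δ G = lam G + (2 / m) H` with `lam = 2
(k₂² - 1) / m²` and `H = P + k₂ R`. Since `H` depends on `s` only, it is harmonic, and `Δ (Δ - lam)
G = 0`, while neither factor annihilates `G`. If `k₂² ≠ 1`, subtracting a multiple of `H` splits `G`
into a harmonic part and an eigenmap for `lam`, so `G` is of null 2-type; by independence of
eigenvectors it has no other type. If `k₂² = 1`, then `lam = 0` and `G` is of infinite type
(`eigenvector_sum_rigid`, `gaussIsKType_iff`). -/

noncomputable section

namespace AdS

/-! ### Uniqueness of spectral decompositions -/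

/-- If `T (T - lam)` annihilates `v`, but neither `T` nor `T - lam` does, then a decomposition of
`v` into eigenvectors of `T` for distinct eigenvalues has exactly two terms, one of them with the
eigenvalue zero. -/
theorem eigenvector_sum_rigid {V : Type*} [AddCommGroup V] [Module ℝ V] (T : Module.End ℝ V)
    (v : V) (lam : ℝ) (h : T (T v - lam • v) = 0) (h₀ : T v ≠ 0) (h₁ : T v ≠ lam • v)
    {k : ℕ} (μ : Fin k → ℝ) (hμ : Function.Injective μ) (ψ : Fin k → V) (hψ : ∀ i, ψ i ≠ 0)
    (hT : ∀ i, T (ψ i) = μ i • ψ i) (hv : v = ∑ i, ψ i) :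
    lam ≠ 0 ∧ k = 2 ∧ ∃ i, μ i = 0 := by
  have hli : LinearIndependent ℝ ψ := Module.End.eigenvectors_linearIndependent' T μ hμ ψ
    fun i => ⟨Module.End.mem_eigenspace_iff.2 (hT i), hψ i⟩
  have hTv : T v = ∑ i, μ i • ψ i := by rw [hv, map_sum]; simp [hT]
  -- Applying `T (T - lam)` to the sum multiplies the `i`-th term by `μ i (μ i - lam)`; by
  -- independence all these factors vanish. Since neither `T` nor `T - lam` annihilates `v`, both
  -- roots must occur.
  have hμ' : ∀ i, μ i = 0 ∨ μ i = lam := by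
    have h2 : ∑ i, (μ i * (μ i - lam)) • ψ i = 0 := by
      rw [← h, hTv, hv, Finset.smul_sum, ← Finset.sum_sub_distrib, map_sum]
      refine Finset.sum_congr rfl fun i _ => ?_
      rw [← sub_smul, map_smul, hT, smul_smul, mul_comm]
    intro i
    have h3 := Fintype.linearIndependent_iff.1 hli _ h2 i
    rcases mul_eq_zero.1 h3 with h3 | h3
    · exact Or.inl h3
    · exact Or.inr (sub_eq_zero.1 h3)
  obtain ⟨i, hi⟩ : ∃ i, μ i = 0 := by
    by_contra! hne
    apply h₁
    rw [hTv, hv, Finset.smul_sum]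
    exact Finset.sum_congr rfl fun i _ => by rw [(hμ' i).resolve_left (hne i)]
  obtain ⟨j, hj⟩ : ∃ j, μ j ≠ 0 := by
    by_contra! hz
    exact h₀ (by rw [hTv]; simp [hz])
  have hjl := (hμ' j).resolve_left hj
  refine ⟨fun hl => hj (hjl.trans hl), ?_, i, hi⟩
  have hij : i ≠ j := fun e => hj (e ▸ hi)
  have huniv : (Finset.univ : Finset (Fin k)) = {i, j} := by
    ext l
    simp only [Finset.mem_univ, Finset.mem_insert, Finset.mem_singleton, true_iff]
    rcases hμ' l with hl | hl
    · exact Or.inl (hμ (hl.trans hi.symm))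
    · exact Or.inr (hμ (hl.trans hjl.symm))
  rw [← Finset.card_fin k, huniv, Finset.card_pair hij]

/-! ### Partial derivatives and the Laplacian as linear operators -/

theorem pd_congr {F : Type*} [NormedAddCommGroup F] [NormedSpace ℝ F] {i : Fin 2}
    {f g : ℝ × ℝ → F} {U : Set (ℝ × ℝ)} (hU : IsOpen U) (h : Set.EqOn f g U) {p : ℝ × ℝ}
    (hp : p ∈ U) : pd i f p = pd i g p := by
  rw [pd, pd, (h.eventuallyEq_of_mem (hU.mem_nhds hp)).fderiv_eq]

theorem eqOn_pd {F : Type*} [NormedAddCommGroup F] [NormedSpace ℝ F] {i : Fin 2}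
    {f g : ℝ × ℝ → F} {U : Set (ℝ × ℝ)} (hU : IsOpen U) (h : Set.EqOn f g U) :
    Set.EqOn (pd i f) (pd i g) U := fun _ hp => pd_congr hU h hp

theorem contDiffOn_pd {F : Type*} [NormedAddCommGroup F] [NormedSpace ℝ F] {f : ℝ × ℝ → F}
    {U : Set (ℝ × ℝ)} (hU : IsOpen U) (hf : ContDiffOn ℝ ∞ f U) (i : Fin 2) :
    ContDiffOn ℝ ∞ (pd i f) U :=
  (hf.fderiv_of_isOpen hU le_rfl).clm_apply contDiffOn_const

theorem laplacian_congr (g : ℝ × ℝ → Matrix (Fin 2) (Fin 2) ℝ) {f f' : ℝ × ℝ → ℝ}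
    {U : Set (ℝ × ℝ)} (hU : IsOpen U) (h : Set.EqOn f f' U) {p : ℝ × ℝ} (hp : p ∈ U) :
    laplacian g f p = laplacian g f' p := by
  simp only [laplacian]
  congr 1
  refine Finset.sum_congr rfl fun i _ => Finset.sum_congr rfl fun j _ => ?_
  rw [pd_congr hU (eqOn_pd hU h) hp]
  congr 2
  exact Finset.sum_congr rfl fun k _ => by rw [pd_congr hU h hp]

/-- The smooth real functions on the open set `U`, extended by zero. -/
def smoothFun (U : Set (ℝ × ℝ)) : Submodule ℝ (ℝ × ℝ → ℝ) where
  carrier := {f | ContDiffOn ℝ ∞ f U ∧ ∀ p ∉ U, f p = 0}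
  add_mem' hf hg := ⟨hf.1.add hg.1, fun p hp => by simp [hf.2 p hp, hg.2 p hp]⟩
  zero_mem' := ⟨contDiffOn_const, fun _ _ => rfl⟩
  smul_mem' c _ hf := ⟨hf.1.const_smul c, fun p hp => by simp [hf.2 p hp]⟩

/-- A function that is smooth on `U`, cut off outside `U`. -/
def restrictFun (U : Set (ℝ × ℝ)) (f : ℝ × ℝ → ℝ) (hf : ContDiffOn ℝ ∞ f U) : smoothFun U :=
  ⟨U.indicator f, hf.congr fun _ hp => Set.indicator_of_mem hp f,
    fun _ hp => Set.indicator_of_notMem hp f⟩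

theorem restrictFun_apply {U : Set (ℝ × ℝ)} {f : ℝ × ℝ → ℝ} (hf : ContDiffOn ℝ ∞ f U)
    {p : ℝ × ℝ} (hp : p ∈ U) : (restrictFun U f hf).1 p = f p :=
  Set.indicator_of_mem hp f

/-- The extension by zero makes equality in `smoothFun U` the same as equality on `U`. Hence the
Laplacian on `U` is a genuine endomorphism, and linear independence of eigenvectors can be used. -/
theorem smoothFun_ext {U : Set (ℝ × ℝ)} {f g : smoothFun U} (h : ∀ p ∈ U, f.1 p = g.1 p) :
    f = g := by
  ext p
  by_cases hp : p ∈ U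
  · exact h p hp
  · rw [f.2.2 p hp, g.2.2 p hp]

/-- The partial derivative as an operator on the smooth functions on `U`. -/
def pdOp {U : Set (ℝ × ℝ)} (hU : IsOpen U) (i : Fin 2) : Module.End ℝ (smoothFun U) where
  toFun f := restrictFun U (pd i f.1) (contDiffOn_pd hU f.2.1 i)
  map_add' f g := smoothFun_ext fun p hp => by
    have hd : ∀ f : smoothFun U, DifferentiableAt ℝ f.1 p := fun f =>
      (f.2.1.contDiffAt (hU.mem_nhds hp)).differentiableAt (by simp)
    simp only [Submodule.coe_add, Pi.add_apply, restrictFun_apply _ hp, pd]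
    rw [fderiv_add (hd f) (hd g)]
    rfl
  map_smul' c f := smoothFun_ext fun p hp => by
    have hd : DifferentiableAt ℝ f.1 p :=
      (f.2.1.contDiffAt (hU.mem_nhds hp)).differentiableAt (by simp)
    simp only [Submodule.coe_smul, Pi.smul_apply, restrictFun_apply _ hp, pd, RingHom.id_apply]
    rw [fderiv_const_smul hd]
    rfl

/-- Multiplication by a function that is smooth on `U`. -/
def mulOp {U : Set (ℝ × ℝ)} (c : ℝ × ℝ → ℝ) (hc : ContDiffOn ℝ ∞ c U) :
    Module.End ℝ (smoothFun U) where
  toFun f := ⟨fun p => c p * f.1 p, hc.mul f.2.1, fun p hp => by simp [f.2.2 p hp]⟩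
  map_add' f g := by ext p; simp [mul_add]
  map_smul' a f := by ext p; simp [mul_left_comm]

theorem pdOp_apply {U : Set (ℝ × ℝ)} (hU : IsOpen U) (i : Fin 2) (f : smoothFun U) {p : ℝ × ℝ}
    (hp : p ∈ U) : (pdOp hU i f).1 p = pd i f.1 p :=
  restrictFun_apply (contDiffOn_pd hU f.2.1 i) hp

/-- The metric `g` has smooth inverse and Christoffel symbols on `U`. -/
structure IsSmoothMetric (g : ℝ × ℝ → Matrix (Fin 2) (Fin 2) ℝ) (U : Set (ℝ × ℝ)) : Prop where
  isOpen : IsOpen U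
  inv : ∀ i j, ContDiffOn ℝ ∞ (fun p => (g p)⁻¹ i j) U
  christoffel : ∀ k i j, ContDiffOn ℝ ∞ (christoffel g k i j) U

/-- The Laplacian as an operator on the smooth functions on `U`. -/
def lapOp {g : ℝ × ℝ → Matrix (Fin 2) (Fin 2) ℝ} {U : Set (ℝ × ℝ)} (hg : IsSmoothMetric g U) :
    Module.End ℝ (smoothFun U) :=
  -∑ i, ∑ j, mulOp _ (hg.inv i j) * (pdOp hg.isOpen i * pdOp hg.isOpen j
    - ∑ k, mulOp _ (hg.christoffel k i j) * pdOp hg.isOpen k)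

theorem lapOp_apply {g : ℝ × ℝ → Matrix (Fin 2) (Fin 2) ℝ} {U : Set (ℝ × ℝ)}
    (hg : IsSmoothMetric g U) (f : smoothFun U) {p : ℝ × ℝ} (hp : p ∈ U) :
    (lapOp hg f).1 p = laplacian g f.1 p := by
  have h2 : ∀ i j, (pdOp hg.isOpen i (pdOp hg.isOpen j f)).1 p = pd i (pd j f.1) p := by
    intro i j
    rw [pdOp_apply _ _ _ hp]
    exact pd_congr hg.isOpen (fun q hq => pdOp_apply _ _ _ hq) hp
  simp [lapOp, laplacian, mulOp, h2, pdOp_apply _ _ _ hp]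

/-- The Laplacian acting on families of smooth functions. -/
def lapPi (ι : Type*) {g : ℝ × ℝ → Matrix (Fin 2) (Fin 2) ℝ} {U : Set (ℝ × ℝ)}
    (hg : IsSmoothMetric g U) : Module.End ℝ (ι → smoothFun U) :=
  LinearMap.pi fun i => lapOp hg ∘ₗ LinearMap.proj i

/-- The criterion for the type of a map `φ` with `Δ (Δ - lam) φ = 0`, where `φ'` stands for
`Δ φ`. -/
theorem IsSpectralDecomposition.rigid {W : Type*} [AddCommGroup W] [Module ℝ W]
    {g : ℝ × ℝ → Matrix (Fin 2) (Fin 2) ℝ} {U : Set (ℝ × ℝ)} (hg : IsSmoothMetric g U)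
    {φ φ' : ℝ × ℝ → W} {lam : ℝ}
    (hφ : ∀ ℓ : Module.Dual ℝ W, ContDiffOn ℝ ∞ (fun p => ℓ (φ p)) U)
    (hφ' : ∀ ℓ : Module.Dual ℝ W, ∀ p ∈ U, laplacian g (fun q => ℓ (φ q)) p = ℓ (φ' p))
    (hφ'' : ∀ ℓ : Module.Dual ℝ W, ∀ p ∈ U, laplacian g (fun q => ℓ (φ' q - lam • φ q)) p = 0)
    (h₀ : ∃ p ∈ U, φ' p ≠ 0) (h₁ : ∃ p ∈ U, φ' p ≠ lam • φ p)
    {k : ℕ} {μ : Fin k → ℝ} {ψ : Fin k → ℝ × ℝ → W} (h : IsSpectralDecomposition g U φ μ ψ) :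
    lam ≠ 0 ∧ k = 2 ∧ ∃ i, μ i = 0 := by
  -- A `W`-valued map is replaced by the family of all its linear coordinates, on which the
  -- Laplacian acts entry by entry.
  let v : Module.Dual ℝ W → smoothFun U := fun ℓ => restrictFun U _ (hφ ℓ)
  let w : Fin k → Module.Dual ℝ W → smoothFun U := fun i ℓ => restrictFun U _ (h.eigen i ℓ).1
  have hv : ∀ ℓ, ∀ p ∈ U, (v ℓ).1 p = ℓ (φ p) := fun ℓ p hp => restrictFun_apply _ hp
  have hw : ∀ i ℓ, ∀ p ∈ U, (w i ℓ).1 p = ℓ (ψ i p) := fun i ℓ p hp => restrictFun_apply _ hp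
  have hTv : ∀ ℓ, ∀ p ∈ U, (lapPi _ hg v ℓ).1 p = ℓ (φ' p) := by
    intro ℓ p hp
    rw [← hφ' ℓ p hp]
    exact (lapOp_apply hg _ hp).trans (laplacian_congr g hg.isOpen (hv ℓ) hp)
  have dual_eq : ∀ {a b : W}, (∀ ℓ : Module.Dual ℝ W, ℓ a = ℓ b) → a = b := fun hab =>
    sub_eq_zero.1 ((Module.forall_dual_apply_eq_zero_iff ℝ _).1 fun ℓ => by
      rw [map_sub, hab, sub_self])
  refine eigenvector_sum_rigid (lapPi _ hg) v lam ?_ ?_ ?_ μ h.distinct w ?_ ?_ ?_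
  · ext1 ℓ
    refine smoothFun_ext fun p hp => ?_
    refine (lapOp_apply hg _ hp).trans ((laplacian_congr g hg.isOpen ?_ hp).trans (hφ'' ℓ p hp))
    intro q hq
    simp [hTv ℓ q hq, hv ℓ q hq]
  · obtain ⟨p, hp, hne⟩ := h₀
    refine fun h0 => hne (dual_eq fun ℓ => ?_)
    rw [← hTv ℓ p hp, h0]; simp
  · obtain ⟨p, hp, hne⟩ := h₁
    refine fun h1 => hne (dual_eq fun ℓ => ?_)
    rw [← hTv ℓ p hp, h1]; simp [hv ℓ p hp]
  · intro i hi
    obtain ⟨p, hp, q, hq, hne⟩ := h.nonconst i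
    refine hne (dual_eq fun ℓ => ?_)
    rw [← hw i ℓ p hp, ← hw i ℓ q hq, hi]; simp
  · intro i
    ext1 ℓ
    refine smoothFun_ext fun p hp => ?_
    refine (lapOp_apply hg _ hp).trans ((laplacian_congr g hg.isOpen (hw i ℓ) hp).trans ?_)
    rw [(h.eigen i ℓ).2 p hp]
    simp [hw i ℓ p hp]
  · ext1 ℓ
    refine smoothFun_ext fun p hp => ?_
    rw [hv ℓ p hp, h.sum_eq p hp, map_sum]
    simp [hw _ ℓ p hp]

/-! ### Functions of one variable -/

/-- Bootstrapping for differential equations: if the right-hand side is as smooth as the solution,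
each order of smoothness yields the next. It serves for primitives, inverse functions and Riccati
solutions. -/
theorem contDiffOn_infty_of_hasDerivAt {F : Type*} [NormedAddCommGroup F] [NormedSpace ℝ F]
    {J : Set ℝ} (hJ : IsOpen J) {f f' : ℝ → F} (hf : ∀ s ∈ J, HasDerivAt f (f' s) s)
    (h : ∀ n : ℕ, ContDiffOn ℝ n f J → ContDiffOn ℝ n f' J) : ContDiffOn ℝ ∞ f J := by
  refine contDiffOn_infty.2 fun n => ?_
  induction n with
  | zero => exact contDiffOn_zero.2 fun s hs => (hf s hs).continuousAt.continuousWithinAt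
  | succ n ih =>
    rw [Nat.cast_succ, contDiffOn_succ_iff_deriv_of_isOpen hJ]
    refine ⟨fun s hs => (hf s hs).differentiableAt.differentiableWithinAt, by simp, ?_⟩
    exact (h n ih).congr fun s hs => (hf s hs).deriv

theorem exists_primitive {J : Set ℝ} (hJ : IsOpen J) (hJ' : J.OrdConnected) {f : ℝ → ℝ}
    (hf : ContinuousOn f J) : ∃ F : ℝ → ℝ, ∀ s ∈ J, HasDerivAt F (f s) s := by
  rcases J.eq_empty_or_nonempty with rfl | ⟨s₀, hs₀⟩
  · exact ⟨0, by simp⟩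
  refine ⟨fun s => ∫ τ in s₀..s, f τ, fun s hs => ?_⟩
  refine intervalIntegral.integral_hasDerivAt_right ?_ ?_ (hf.continuousAt (hJ.mem_nhds hs))
  · exact (hf.mono (hJ'.uIcc_subset hs₀ hs)).intervalIntegrable
  · exact hf.stronglyMeasurableAtFilter hJ s hs

/-- A function with positive derivative on an open interval has an inverse on the image, which is
again an open interval. -/
theorem exists_inverse {J : Set ℝ} (hJ : IsOpen J) (hJ' : J.OrdConnected) {θ ρ : ℝ → ℝ}
    (hθ : ∀ s ∈ J, HasDerivAt θ (ρ s) s) (hρ : ∀ s ∈ J, 0 < ρ s) (hρ' : ContDiffOn ℝ ∞ ρ J) :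
    IsOpen (θ '' J) ∧ (θ '' J).OrdConnected ∧ ∃ η : ℝ → ℝ, Set.MapsTo η (θ '' J) J ∧
      Set.InvOn η θ J (θ '' J) ∧ ContDiffOn ℝ ∞ η (θ '' J) ∧
      ∀ τ ∈ θ '' J, HasDerivAt η (ρ (η τ))⁻¹ τ := by
  have hc : ContinuousOn θ J := fun s hs => (hθ s hs).continuousAt.continuousWithinAt
  have hmono : StrictMonoOn θ J := by
    refine strictMonoOn_of_deriv_pos hJ'.convex hc fun s hs => ?_
    rw [hJ.interior_eq] at hs
    rw [(hθ s hs).deriv]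
    exact hρ s hs
  have hord : (θ '' J).OrdConnected := (hJ'.isPreconnected.image θ hc).ordConnected
  -- A nonzero strict derivative makes `θ` open. This yields both the openness of the image and the
  -- continuity of the inverse.
  have hnhds : ∀ s ∈ J, ∀ V ∈ nhds s, θ '' V ∈ nhds (θ s) := by
    intro s hs V hV
    have hst : HasStrictDerivAt θ (ρ s) s := by
      have h1 : ContDiffAt ℝ 1 θ s := by
        have : ContDiffOn ℝ ∞ θ J := contDiffOn_infty_of_hasDerivAt hJ hθ
          fun n _ => hρ'.of_le (by exact_mod_cast le_top)
        exact (this.contDiffAt (hJ.mem_nhds hs)).of_le (by simp)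
      exact h1.hasStrictDerivAt' (hθ s hs) one_ne_zero
    rw [← hst.map_nhds_eq (hρ s hs).ne']
    exact Filter.image_mem_map hV
  have hopen : IsOpen (θ '' J) := by
    rw [isOpen_iff_mem_nhds]
    rintro _ ⟨s, hs, rfl⟩
    exact hnhds s hs J (hJ.mem_nhds hs)
  obtain ⟨η, hη⟩ : ∃ η : ℝ → ℝ, Set.InvOn η θ J (θ '' J) ∧ Set.MapsTo η (θ '' J) J := by
    refine ⟨Function.invFunOn θ J, ⟨hmono.injOn.leftInvOn_invFunOn, ?_⟩, ?_⟩
    · rintro _ ⟨s, hs, rfl⟩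
      exact Function.invFunOn_eq ⟨s, hs, rfl⟩
    · rintro _ ⟨s, hs, rfl⟩
      exact Function.invFunOn_mem ⟨s, hs, rfl⟩
  obtain ⟨hinv, hmaps⟩ := hη
  have hηc : ∀ τ ∈ θ '' J, ContinuousAt η τ := by
    rintro _ ⟨s, hs, rfl⟩
    rw [ContinuousAt, hinv.1 hs]
    intro V hV
    have h := hnhds s hs (V ∩ J) (Filter.inter_mem hV (hJ.mem_nhds hs))
    refine Filter.mem_map.2 (Filter.mem_of_superset h ?_)
    rintro _ ⟨r, hr, rfl⟩
    rw [Set.mem_preimage, hinv.1 hr.2]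
    exact hr.1
  have hηd : ∀ τ ∈ θ '' J, HasDerivAt η (ρ (η τ))⁻¹ τ := by
    intro τ hτ
    exact (hθ _ (hmaps hτ)).of_local_left_inverse (hηc τ hτ) (hρ _ (hmaps hτ)).ne'
      (Filter.mem_of_superset (hopen.mem_nhds hτ) fun r hr => hinv.2 hr)
  refine ⟨hopen, hord, η, hmaps, hinv, ?_, hηd⟩
  refine contDiffOn_infty_of_hasDerivAt hopen hηd fun n hn => ?_
  refine ContDiffOn.inv (ContDiffOn.comp (hρ'.of_le (by exact_mod_cast le_top)) hn hmaps) ?_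
  exact fun τ hτ => (hρ _ (hmaps hτ)).ne'

/-- Existence for a Riccati equation with small coefficients. -/
theorem exists_riccati {p q c b κ r : ℝ} {k : ℝ → ℝ} (hpq : p < q) (hr : 0 < r)
    (hk : ContinuousOn k (Set.Icc p q)) (hκ : ∀ s ∈ Set.Icc p q, |k s| ≤ κ)
    (h : (|c| * r ^ 2 + |b| * κ) * (q - p) ≤ r) :
    ∃ f : ℝ → ℝ, ∀ s ∈ Set.Ioo p q, HasDerivAt f (c * f s ^ 2 - b * k s) s := by
  have hp : p ∈ Set.Icc p q := ⟨le_rfl, hpq.le⟩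
  have hκ0 : 0 ≤ κ := (abs_nonneg _).trans (hκ p hp)
  -- Picard–Lindelöf with `f p = 0` in the ball `|y| ≤ r`: there the speed is at most `|c| r² + |b|
  -- κ` and the Lipschitz constant is `2 |c| r`. The hypothesis `h` keeps the solution in the ball
  -- throughout `[p, q]`.
  have hPL : IsPicardLindelof (fun s y => c * y ^ 2 - b * k s) (⟨p, hp⟩ : Set.Icc p q) (0 : ℝ)
      (.mk r hr.le) 0 (.mk (|c| * r ^ 2 + |b| * κ) (by positivity))
      (.mk (|c| * (2 * r)) (by positivity)) := by
    constructor
    · intro s _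
      refine LipschitzOnWith.of_dist_le_mul fun y hy z hz => ?_
      simp only [Metric.mem_closedBall, dist_zero_right, Real.norm_eq_abs, NNReal.coe_mk] at hy hz
      rw [Real.dist_eq, Real.dist_eq, NNReal.coe_mk,
        show c * y ^ 2 - b * k s - (c * z ^ 2 - b * k s) = c * (y + z) * (y - z) by ring,
        abs_mul, abs_mul]
      gcongr
      exact (abs_add_le _ _).trans (by linarith)
    · intro y _
      exact continuousOn_const.sub (continuousOn_const.mul hk)
    · intro s hs y hy
      simp only [Metric.mem_closedBall, dist_zero_right, Real.norm_eq_abs, NNReal.coe_mk] at hy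
      rw [Real.norm_eq_abs, NNReal.coe_mk]
      refine (abs_sub _ _).trans ?_
      rw [abs_mul, abs_mul, abs_pow]
      gcongr
      exact hκ s hs
    · simp only [NNReal.coe_mk, NNReal.coe_zero, sub_zero, sub_self]
      rwa [max_eq_left (by linarith)]
  obtain ⟨f, -, hf⟩ := hPL.exists_eq_forall_mem_Icc_hasDerivWithinAt₀
  exact ⟨f, fun s hs => (hf s (Set.Ioo_subset_Icc_self hs)).hasDerivAt (Icc_mem_nhds hs.1 hs.2)⟩

/-! ### The scalar product -/

theorem ip_comm (v w : E42) : ip v w = ip w v := by simp only [ip]; ring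

theorem ip_add_left (v w z : E42) : ip (v + w) z = ip v z + ip w z := by
  simp only [ip, Pi.add_apply]; ring

theorem ip_sub_left (v w z : E42) : ip (v - w) z = ip v z - ip w z := by
  simp only [ip, Pi.sub_apply]; ring

theorem ip_smul_left (c : ℝ) (v z : E42) : ip (c • v) z = c * ip v z := by
  simp only [ip, Pi.smul_apply, smul_eq_mul]; ring

theorem ip_add_right (v w z : E42) : ip z (v + w) = ip z v + ip z w := by
  simp only [ip, Pi.add_apply]; ring

theorem ip_sub_right (v w z : E42) : ip z (v - w) = ip z v - ip z w := by
  simp only [ip, Pi.sub_apply]; ring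

theorem ip_smul_right (c : ℝ) (v z : E42) : ip z (c • v) = c * ip z v := by
  simp only [ip, Pi.smul_apply, smul_eq_mul]; ring

theorem ContDiffOn.ip {E : Type*} [NormedAddCommGroup E] [NormedSpace ℝ E] {f g : E → E42}
    {U : Set E} (hf : ContDiffOn ℝ ∞ f U) (hg : ContDiffOn ℝ ∞ g U) :
    ContDiffOn ℝ ∞ (fun p => ip (f p) (g p)) U := by
  rw [contDiffOn_pi] at hf hg
  exact ((((hf 0).mul (hg 0)).neg.sub ((hf 1).mul (hg 1))).add
    ((hf 2).mul (hg 2))).add ((hf 3).mul (hg 3))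

/-! ### Cartan frames, and null base curves from the Riccati equation -/

namespace IsCartanFrame

variable {I : Set ℝ} {γ A B C : ℝ → E42} {k₁ : ℝ → ℝ} {k₂ : ℝ}

theorem ip_table (hM : IsCartanFrame I γ A B C k₁ k₂) {s : ℝ} (hs : s ∈ I) :
    ip (γ s) (γ s) = -1 ∧ ip (A s) (A s) = 0 ∧ ip (B s) (B s) = 0 ∧ ip (C s) (C s) = 1 ∧
    ip (A s) (γ s) = 0 ∧ ip (γ s) (A s) = 0 ∧ ip (B s) (γ s) = 0 ∧ ip (γ s) (B s) = 0 ∧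
    ip (C s) (γ s) = 0 ∧ ip (γ s) (C s) = 0 ∧ ip (A s) (B s) = -1 ∧ ip (B s) (A s) = -1 ∧
    ip (A s) (C s) = 0 ∧ ip (C s) (A s) = 0 ∧ ip (B s) (C s) = 0 ∧ ip (C s) (B s) = 0 := by
  obtain ⟨h1, h2, h3⟩ := hM.tangent s hs
  obtain ⟨h4, h5⟩ := hM.null s hs
  obtain ⟨h6, h7, h8⟩ := hM.orth s hs
  have h9 := hM.pair s hs
  exact ⟨hM.mem s hs, h4, h5, h8, h1, ip_comm _ _ ▸ h1, h2, ip_comm _ _ ▸ h2, h3,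
    ip_comm _ _ ▸ h3, h9, ip_comm _ _ ▸ h9, h6, ip_comm _ _ ▸ h6, h7, ip_comm _ _ ▸ h7⟩

/-- Smoothness of `k₁` is not part of the definition of a Cartan frame; it follows from `k₁ = -⟨C',
A⟩`. -/
theorem contDiffOn_k₁ (hM : IsCartanFrame I γ A B C k₁ k₂) : ContDiffOn ℝ ∞ k₁ I := by
  have h : ContDiffOn ℝ ∞ (deriv C) I :=
    ((contDiffOn_infty_iff_deriv_of_isOpen hM.isOpen).1 hM.smooth_C).2
  refine (ContDiffOn.ip h hM.smooth_A).neg.congr fun s hs => ?_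
  obtain ⟨-, hAA, -, -, -, -, -, -, -, -, -, hBA, -⟩ := hM.ip_table hs
  rw [(hM.deriv_C s hs).deriv, ip_add_left, ip_smul_left, ip_smul_left, hAA, hBA]
  ring

/-- If `f` solves the Riccati equation `f' = c f² - b k₁`, then the curve `a γ + b C + f B` on the
ruled surface with base curve `a γ + b C` and rulings along `B` is null, and it has a Cartan frame
in a suitable parametrization. -/
theorem isBScroll_of_riccati (hM : IsCartanFrame I γ A B C k₁ k₂) {J : Set ℝ} (hJI : J ⊆ I)
    (hJ : IsOpen J) (hJ₀ : J.Nonempty) (hJ' : J.OrdConnected) {a b c : ℝ}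
    (hab : a ^ 2 - b ^ 2 = 1) (hm : a + b * k₂ ≠ 0) (hc : 2 * c * (a + b * k₂) = k₂ ^ 2 - 1)
    {f : ℝ → ℝ} (hf : ∀ s ∈ J, HasDerivAt f (c * f s ^ 2 - b * k₁ s) s)
    {x : ℝ × ℝ → E42} (hx : Set.EqOn x
      (fun p => (a • γ p.1 + b • C p.1) + (p.2 * (a + b * k₂)) • B p.1) (strip J)) :
    IsBScroll x (strip J) ((b + a * k₂) * (a + b * k₂)⁻¹) := by
  set m := a + b * k₂ with hm_def
  set n := b + a * k₂ with hn_def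
  -- The inverse of `m` becomes a variable with `i m = 1`, and `ρ`, `r` below satisfy `ρ r = 1`, so
  -- that all frame identities are polynomial consequences of a few relations.
  obtain ⟨i, hi⟩ : ∃ i, i = m⁻¹ := ⟨_, rfl⟩
  have him : i * m = 1 := by rw [hi, inv_mul_cancel₀ hm]
  rw [← hi]
  have hk₁ : ContDiffOn ℝ ∞ k₁ J := hM.contDiffOn_k₁.mono hJI
  have hfs : ContDiffOn ℝ ∞ f J := contDiffOn_infty_of_hasDerivAt hJ hf fun k hk =>
    (contDiffOn_const.mul (hk.pow 2)).sub
      (contDiffOn_const.mul (hk₁.of_le (by exact_mod_cast le_top)))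
  obtain ⟨F, hF⟩ := exists_primitive hJ hJ' hfs.continuousOn
  have hFs : ContDiffOn ℝ ∞ F J := contDiffOn_infty_of_hasDerivAt hJ hF fun k _ =>
    hfs.of_le (by exact_mod_cast le_top)
  -- `ρ = dτ/ds` is the speed of the new parameter. Comparing the `B`-components in `dB'/dτ = (n /
  -- m) C' - σ` forces `ρ' / ρ = f (n² - m²) / m`. Since `n² - m² = (a² - b²)(k₂² - 1) = k₂² - 1`,
  -- this is `2 c f`.
  obtain ⟨ρ, hρ⟩ : ∃ ρ : ℝ → ℝ, ρ = fun s => Real.exp (2 * c * F s) := ⟨_, rfl⟩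
  obtain ⟨r, hr⟩ : ∃ r : ℝ → ℝ, r = fun s => Real.exp (-(2 * c) * F s) := ⟨_, rfl⟩
  have hρ0 : ∀ s, 0 < ρ s := fun s => by rw [hρ]; exact Real.exp_pos _
  have hr0 : ∀ s, 0 < r s := fun s => by rw [hr]; exact Real.exp_pos _
  have hρr : ∀ s, ρ s * r s = 1 := fun s => by
    rw [hρ, hr]; simp only; rw [← Real.exp_add, Real.exp_eq_one_iff]; ring
  have hρd : ∀ s ∈ J, HasDerivAt ρ (2 * c * f s * ρ s) s := fun s hs => by
    rw [hρ]; exact (((hF s hs).const_mul (2 * c)).exp).congr_deriv (by ring)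
  have hrd : ∀ s ∈ J, HasDerivAt r (-(2 * c) * f s * r s) s := fun s hs => by
    rw [hr]; exact (((hF s hs).const_mul (-(2 * c))).exp).congr_deriv (by ring)
  have hρs : ContDiffOn ℝ ∞ ρ J := by
    rw [hρ]; exact (contDiffOn_const.mul hFs).exp
  have hrs : ContDiffOn ℝ ∞ r J := by
    rw [hr]; exact (contDiffOn_const.mul hFs).exp
  clear hρ hr
  obtain ⟨θ, hθ⟩ := exists_primitive hJ hJ' hρs.continuousOn
  have hθs : ContDiffOn ℝ ∞ θ J := contDiffOn_infty_of_hasDerivAt hJ hθ fun k _ =>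
    hρs.of_le (by exact_mod_cast le_top)
  obtain ⟨hopen, hord, η, hmaps, hinv, hηs, hηd⟩ :=
    exists_inverse hJ hJ' hθ (fun s _ => hρ0 s) hρs
  have hγs := hM.smooth_γ.mono hJI
  have hAs := hM.smooth_A.mono hJI
  have hBs := hM.smooth_B.mono hJI
  have hCs := hM.smooth_C.mono hJI
  have hcomp : ∀ {G G' : ℝ → E42} {τ : ℝ}, τ ∈ θ '' J → HasDerivAt G (ρ (η τ) • G' (η τ)) (η τ) →
      HasDerivAt (G ∘ η) (G' (η τ)) τ := by
    intro G G' τ hτ h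
    refine (h.scomp τ (hηd τ hτ)).congr_deriv ?_
    rw [smul_smul, inv_mul_cancel₀ (hρ0 _).ne', one_smul]
  -- The new frame: `A'` is `dσ/dτ`, with the Riccati equation inserted; `B'` rescales `B` so that
  -- `⟨A', B'⟩ = -1`; and `C'` is `b γ + a C` corrected along `B` to be orthogonal to `A'`.
  let σ : ℝ → E42 := fun s => (a • γ s + b • C s) + f s • B s
  let A' : ℝ → E42 := fun s => r s • (m • A s + f s • (k₂ • C s - γ s) + (c * f s ^ 2) • B s)
  let B' : ℝ → E42 := fun s => (ρ s * i) • B s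
  let C' : ℝ → E42 := fun s => (b • γ s + a • C s) + (f s * (n * i)) • B s
  have hσs : ContDiffOn ℝ ∞ σ J := ((hγs.const_smul a).add (hCs.const_smul b)).add (hfs.smul hBs)
  have hA's : ContDiffOn ℝ ∞ A' J := hrs.smul (((hAs.const_smul m).add
    (hfs.smul ((hCs.const_smul k₂).sub hγs))).add ((contDiffOn_const.mul (hfs.pow 2)).smul hBs))
  have hB's : ContDiffOn ℝ ∞ B' J := (hρs.mul contDiffOn_const).smul hBs
  have hC's : ContDiffOn ℝ ∞ C' J :=
    ((hγs.const_smul b).add (hCs.const_smul a)).add ((hfs.mul contDiffOn_const).smul hBs)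
  refine ⟨θ '' J, σ ∘ η, A' ∘ η, B' ∘ η, C' ∘ η, fun τ => k₁ (η τ) * r (η τ) ^ 2, ?_, ?_⟩
  · have table : ∀ τ ∈ θ '' J, _ := fun τ hτ => hM.ip_table (hJI (hmaps hτ))
    refine ⟨hopen, hJ₀.image θ, hord, hσs.comp hηs hmaps, hA's.comp hηs hmaps,
      hB's.comp hηs hmaps, hC's.comp hηs hmaps, ?_, ?_, ?_, ?_, ?_, ?_, ?_, ?_, ?_, ?_⟩
    · intro τ hτ
      obtain ⟨h1, h2, h3, h4, h5, h6, h7, h8, h9, h10, h11, h12, h13, h14, h15, h16⟩ := table τ hτ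
      simp only [H31, Set.mem_ofPred_eq, Function.comp, σ, ip_add_left, ip_smul_left, ip_add_right,
        ip_smul_right, h1, h3, h4, h7, h8, h9, h10, h15, h16]
      linear_combination -hab
    · intro τ hτ
      obtain ⟨h1, h2, h3, h4, h5, h6, h7, h8, h9, h10, h11, h12, h13, h14, h15, h16⟩ := table τ hτ
      simp only [Function.comp, σ, A', B', C', ip_add_left, ip_smul_left, ip_add_right,
        ip_smul_right, ip_sub_left, h1, h3, h4, h5, h7, h8, h9, h10, h11, h13, h15, h16]
      refine ⟨?_, by ring, by ring⟩
      rw [hm_def]; ring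
    · intro τ hτ
      obtain ⟨h1, h2, h3, h4, h5, h6, h7, h8, h9, h10, h11, h12, h13, h14, h15, h16⟩ := table τ hτ
      simp only [Function.comp, A', B', ip_add_left, ip_smul_left, ip_add_right,
        ip_smul_right, ip_sub_left, ip_sub_right, h1, h2, h3, h4, h5, h6, h7, h8, h9, h10, h11,
        h12, h13, h14, h15, h16]
      refine ⟨?_, by ring⟩
      linear_combination (-r (η τ) ^ 2 * f (η τ) ^ 2) * hc
    · intro τ hτ
      obtain ⟨h1, h2, h3, h4, h5, h6, h7, h8, h9, h10, h11, h12, h13, h14, h15, h16⟩ := table τ hτ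
      simp only [Function.comp, A', B', ip_add_left, ip_smul_left,
        ip_smul_right, ip_sub_left, h3, h8, h11, h16]
      linear_combination (-(i * m)) * hρr (η τ) - him
    · intro τ hτ
      obtain ⟨h1, h2, h3, h4, h5, h6, h7, h8, h9, h10, h11, h12, h13, h14, h15, h16⟩ := table τ hτ
      simp only [Function.comp, A', B', C', ip_add_left, ip_smul_left, ip_add_right,
        ip_smul_right, ip_sub_left, h1, h3, h4, h5, h7, h8, h9, h10, h11, h13, h15, h16]
      refine ⟨?_, by ring, ?_⟩
      · rw [hn_def]; linear_combination (-r (η τ) * f (η τ) * (b + a * k₂)) * him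
      · linear_combination hab
    · intro τ hτ
      refine hcomp (G' := A') hτ ?_
      have hs := hmaps hτ
      refine ((((hM.deriv_γ _ (hJI hs)).const_smul a).add
        ((hM.deriv_C _ (hJI hs)).const_smul b)).add
        ((hf _ hs).smul (hM.deriv_B _ (hJI hs)))).congr_deriv ?_
      simp only [A']
      rw [smul_smul, hρr, one_smul, hm_def]
      module
    · intro τ hτ
      refine hcomp (G' := fun s => (k₁ s * r s ^ 2) • C' s) hτ ?_
      have hs := hmaps hτ
      refine ((hrd _ hs).smul ((((hM.deriv_A _ (hJI hs)).const_smul m).add ((hf _ hs).smul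
        (((hM.deriv_C _ (hJI hs)).const_smul k₂).sub (hM.deriv_γ _ (hJI hs))))).add
        ((((hf _ hs).pow 2).const_mul c).smul (hM.deriv_B _ (hJI hs))))).congr_deriv ?_
      generalize η τ = s
      simp only [C', smul_smul]
      rw [show ρ s * (k₁ s * r s ^ 2) = k₁ s * r s by linear_combination k₁ s * r s * hρr s]
      simp only [Nat.cast_ofNat, Pi.add_apply, Pi.smul_apply, Pi.sub_apply, Pi.pow_apply,
        Pi.smul_apply']
      match_scalars
      · linear_combination r s * k₁ s * hm_def
      · linear_combination -r s * f s * hc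
      · linear_combination r s * f s * k₁ s * (i * (k₂ * hm_def - hn_def - b * hc)
          + (2 * c * b - k₂) * him)
      · ring
    · intro τ hτ
      refine hcomp (G' := fun s => (n * i) • A' s + (k₁ s * r s ^ 2) • B' s) hτ ?_
      have hs := hmaps hτ
      refine ((((hM.deriv_γ _ (hJI hs)).const_smul b).add
        ((hM.deriv_C _ (hJI hs)).const_smul a)).add
        (((hf _ hs).mul_const (n * i)).smul (hM.deriv_B _ (hJI hs)))).congr_deriv ?_
      generalize η τ = s
      simp only [A', B']
      match_scalars
      · linear_combination (-n * ρ s * r s) * him - n * hρr s - hn_def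
      · linear_combination (-(a * k₁ s)) * him + k₁ s * i * (hab + a * hm_def - b * hn_def)
          - (k₁ s * i * (r s * ρ s + 1) + n * c * i * f s ^ 2) * hρr s
      · linear_combination (-(n * i * k₂ * f s)) * hρr s
      · linear_combination n * i * f s * hρr s
    · intro τ hτ
      refine hcomp (G' := fun s => (n * i) • C' s - σ s) hτ ?_
      have hs := hmaps hτ
      refine (((hρd _ hs).mul_const i).smul (hM.deriv_B _ (hJI hs))).congr_deriv ?_
      generalize η τ = s
      simp only [C', σ]
      match_scalars
      · linear_combination ρ s * i * (-k₂ * hab - a * hn_def + b * hm_def) - ρ s * b * him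
      · linear_combination ρ s * i * (hab - b * hn_def + a * hm_def) - ρ s * a * him
      · linear_combination ρ s * f s * (i ^ 2 * (hc - (n + b + a * k₂) * hn_def
          + (m + a + b * k₂) * hm_def - (k₂ ^ 2 - 1) * hab) - (2 * c * i + i * m + 1) * him)
    · intro τ hτ
      exact mul_pos (hM.k₁_pos _ (hJI (hmaps hτ))) (pow_pos (hr0 _) 2)
  · have hmJ : Set.MapsTo (Prod.fst : ℝ × ℝ → ℝ) (strip J) J := fun p hp => hp.1
    have hmθ : Set.MapsTo (Prod.fst : ℝ × ℝ → ℝ) (strip (θ '' J)) (θ '' J) := fun p hp => hp.1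
    -- The ruling coordinate `t'` solves `f + t' ρ / m = t m`, which equates the `B`-components of
    -- the two parametrizations.
    refine ⟨fun p => (θ p.1, (p.2 * m - f p.1) * m * r p.1),
      fun p => (η p.1, (p.2 * ρ (η p.1) * i + f (η p.1)) * i), ?_, ?_, ?_, ?_, ⟨?_, ?_⟩, ?_⟩
    · exact (hθs.comp contDiffOn_fst hmJ).prodMk ((((contDiffOn_snd.mul contDiffOn_const).sub
        (hfs.comp contDiffOn_fst hmJ)).mul contDiffOn_const).mul (hrs.comp contDiffOn_fst hmJ))
    · have hη := hηs.comp contDiffOn_fst hmθ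
      have hmη : Set.MapsTo (fun p : ℝ × ℝ => η p.1) (strip (θ '' J)) J := fun p hp => hmaps hp.1
      exact hη.prodMk ((((contDiffOn_snd.mul (hρs.comp hη hmη)).mul contDiffOn_const).add
        (hfs.comp hη hmη)).mul contDiffOn_const)
    · exact fun p hp => ⟨⟨p.1, hp.1, rfl⟩, trivial⟩
    · exact fun p hp => ⟨hmaps hp.1, trivial⟩
    · intro p hp
      have h := hρr p.1
      refine Prod.ext (hinv.1 hp.1) ?_
      simp only [hinv.1 hp.1]
      linear_combination (p.2 * m - f p.1) * m * i ^ 2 * h + ((p.2 * m - f p.1) * i + p.2) * him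
    · intro p hp
      have h := hρr (η p.1)
      refine Prod.ext (hinv.2 hp.1) ?_
      simp only
      linear_combination p.2 * i * m * i * m * h
        + (p.2 * (i * m + 1) + f (η p.1) * m * r (η p.1)) * him
    · intro p hp
      rw [hx hp]
      simp only [scroll, Function.comp, hinv.1 hp.1, σ, B', smul_smul]
      rw [add_assoc (a • γ p.1 + b • C p.1), ← add_smul]
      congr 2
      linear_combination -(p.2 * m - f p.1) * (him + i * m * hρr p.1)

end IsCartanFrame

/-! ### Alternating maps of three vectors -/

section Alternating

variable {N : Type*} [AddCommGroup N] [Module ℝ N] (α : E42 [⋀^Fin 3]→ₗ[ℝ] N)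

theorem vec3_eq_update (u v w : E42) (i : Fin 3) (y : E42) :
    Function.update ![u, v, w] i y = ![if i = 0 then y else u, if i = 1 then y else v,
      if i = 2 then y else w] := by
  ext j : 1
  fin_cases i <;> fin_cases j <;> rfl

theorem alt_comb₀ (r t : ℝ) (y z v w : E42) :
    α ![r • y + t • z, v, w] = r • α ![y, v, w] + t • α ![z, v, w] := by
  have h := fun y => vec3_eq_update 0 v w 0 y
  simp only [Fin.isValue, if_true, Fin.reduceEq, if_false, zero_ne_one] at h
  rw [← h (r • y + t • z), ← h y, ← h z, α.map_update_add, α.map_update_smul,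
    α.map_update_smul]

theorem alt_comb₁ (r t : ℝ) (y z u w : E42) :
    α ![u, r • y + t • z, w] = r • α ![u, y, w] + t • α ![u, z, w] := by
  have h := fun y => vec3_eq_update u 0 w 1 y
  simp only [Fin.isValue, if_true, Fin.reduceEq, if_false, one_ne_zero] at h
  rw [← h (r • y + t • z), ← h y, ← h z, α.map_update_add, α.map_update_smul,
    α.map_update_smul]

theorem alt_comb₂ (r t : ℝ) (y z u v : E42) :
    α ![u, v, r • y + t • z] = r • α ![u, v, y] + t • α ![u, v, z] := by
  have h := fun y => vec3_eq_update u v 0 2 y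
  simp only [Fin.isValue, if_true, Fin.reduceEq, if_false] at h
  rw [← h (r • y + t • z), ← h y, ← h z, α.map_update_add, α.map_update_smul,
    α.map_update_smul]

theorem alt_self₀₁ (v w : E42) : α ![v, v, w] = 0 :=
  α.map_eq_zero_of_eq _ (i := 0) (j := 1) rfl (by decide)

theorem alt_self₀₂ (v w : E42) : α ![v, w, v] = 0 :=
  α.map_eq_zero_of_eq _ (i := 0) (j := 2) rfl (by decide)

theorem alt_self₁₂ (v w : E42) : α ![w, v, v] = 0 :=
  α.map_eq_zero_of_eq _ (i := 1) (j := 2) rfl (by decide)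

theorem alt_swap₀₁ (u v w : E42) : α ![v, u, w] = -α ![u, v, w] := by
  have h := alt_self₀₁ α ((1 : ℝ) • u + (1 : ℝ) • v) w
  rw [alt_comb₀, alt_comb₁, alt_comb₁, alt_self₀₁, alt_self₀₁] at h
  simp only [one_smul, smul_zero, zero_add, add_zero] at h
  exact eq_neg_of_add_eq_zero_right h

theorem alt_swap₁₂ (u v w : E42) : α ![u, w, v] = -α ![u, v, w] := by
  have h := alt_self₁₂ α ((1 : ℝ) • v + (1 : ℝ) • w) u
  rw [alt_comb₁, alt_comb₂, alt_comb₂, alt_self₁₂, alt_self₁₂] at h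
  simp only [one_smul, smul_zero, zero_add, add_zero] at h
  exact eq_neg_of_add_eq_zero_right h

end Alternating

/-- A real alternating map on the pseudo-Euclidean space is continuous. -/
def altCont (α : E42 [⋀^Fin 3]→ₗ[ℝ] ℝ) : ContinuousMultilinearMap ℝ (fun _ : Fin 3 => E42) ℝ where
  toMultilinearMap := α.toMultilinearMap
  cont := by
    have h : ∀ v : Fin 3 → E42, α v
        = ∑ r : Fin 3 → Fin 4, (∏ i, v i (r i)) • α fun i => Pi.single (r i) 1 := by
      intro v
      have hv : v = fun i => ∑ j, v i j • (Pi.single j 1 : E42) := by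
        ext1 i; exact pi_eq_sum_univ' (v i)
      conv_lhs => rw [hv]
      refine (α.toMultilinearMap.map_sum (fun i j => v i j • (Pi.single j 1 : E42))).trans ?_
      exact Finset.sum_congr rfl fun r _ => α.toMultilinearMap.map_smul_univ _ _
    refine Continuous.congr ?_ fun v => (h v).symm
    fun_prop

theorem HasDerivAt.alt (α : E42 [⋀^Fin 3]→ₗ[ℝ] ℝ) {u v w : ℝ → E42} {u' v' w' : E42} {s : ℝ}
    (hu : HasDerivAt u u' s) (hv : HasDerivAt v v' s) (hw : HasDerivAt w w' s) :
    HasDerivAt (fun τ => α ![u τ, v τ, w τ])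
      (α ![u', v s, w s] + α ![u s, v', w s] + α ![u s, v s, w']) s := by
  have h : HasDerivAt (fun τ => ![u τ, v τ, w τ]) ![u', v', w'] s := by
    rw [hasDerivAt_pi]
    intro i
    fin_cases i <;> assumption
  refine (((altCont α).hasFDerivAt _).comp_hasDerivAt s h).congr_deriv ?_
  rw [ContinuousMultilinearMap.linearDeriv_apply, Fin.sum_univ_three]
  simp only [vec3_eq_update]
  rfl

theorem ContDiffOn.alt (α : E42 [⋀^Fin 3]→ₗ[ℝ] ℝ) {u v w : ℝ → E42} {I : Set ℝ}
    (hu : ContDiffOn ℝ ∞ u I) (hv : ContDiffOn ℝ ∞ v I) (hw : ContDiffOn ℝ ∞ w I) :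
    ContDiffOn ℝ ∞ (fun τ => α ![u τ, v τ, w τ]) I := by
  have h : ContDiffOn ℝ ∞ (fun τ => ![u τ, v τ, w τ]) I := by
    rw [contDiffOn_pi]
    intro i
    fin_cases i <;> assumption
  exact (altCont α).contDiff.comp_contDiffOn h

/-- The determinant with first row `v`, as a linear form on the third exterior power. -/
theorem exists_dual_det (v : E42) : ∃ ℓ : Module.Dual ℝ (⋀[ℝ]^3 E42), ∀ z : Fin 3 → E42,
    ℓ (exteriorPower.ιMulti ℝ 3 z) = Matrix.det (Matrix.of (Matrix.vecCons v z)) :=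
  ⟨exteriorPower.alternatingMapLinearEquiv (Matrix.detRowAlternating.curryLeft v), fun z => by
    rw [exteriorPower.alternatingMapLinearEquiv_apply_ιMulti]; rfl⟩

/-! ### The Cartan frame as a basis -/

namespace IsCartanFrame

variable {I : Set ℝ} {γ A B C : ℝ → E42} {k₁ : ℝ → ℝ} {k₂ : ℝ}

theorem linearIndependent (hM : IsCartanFrame I γ A B C k₁ k₂) {s : ℝ} (hs : s ∈ I) :
    LinearIndependent ℝ ![γ s, A s, B s, C s] := by
  obtain ⟨h1, h2, h3, h4, h5, h6, h7, h8, h9, h10, h11, h12, h13, h14, h15, h16⟩ :=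
    hM.ip_table hs
  rw [Fintype.linearIndependent_iff]
  intro c hc
  have key : ∀ v : E42, ip (c 0 • γ s + c 1 • A s + c 2 • B s + c 3 • C s) v = 0 := by
    intro v
    have : c 0 • γ s + c 1 • A s + c 2 • B s + c 3 • C s = 0 := by
      rw [← hc, Fin.sum_univ_four]; rfl
    rw [this]; simp [ip]
  have e0 := key (γ s)
  have e1 := key (A s)
  have e2 := key (B s)
  have e3 := key (C s)
  simp only [ip_add_left, ip_smul_left, h1, h2, h3, h4, h5, h6, h7, h8, h9, h10, h11, h12, h13,
    h14, h15, h16] at e0 e1 e2 e3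
  intro i
  fin_cases i <;> simp only [Fin.zero_eta, Fin.mk_one, Fin.reduceFinMk] <;> linarith

theorem det_ne_zero (hM : IsCartanFrame I γ A B C k₁ k₂) {s : ℝ} (hs : s ∈ I) (σ : Fin 4 → Fin 4)
    (hσ : Function.Injective σ) :
    Matrix.det (Matrix.of (![γ s, A s, B s, C s] ∘ σ)) ≠ 0 := by
  have h := (hM.linearIndependent hs).comp σ hσ
  have h' := Matrix.linearIndependent_rows_iff_isUnit.1
    (show LinearIndependent ℝ (Matrix.of (![γ s, A s, B s, C s] ∘ σ)).row from h)
  exact ((Matrix.isUnit_iff_isUnit_det _).1 h').ne_zero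

theorem eq_frame_sum (hM : IsCartanFrame I γ A B C k₁ k₂) {s : ℝ} (hs : s ∈ I) (v : E42) :
    v = (-ip v (γ s)) • γ s + (-ip v (B s)) • A s + (-ip v (A s)) • B s + ip v (C s) • C s := by
  obtain ⟨h1, h2, h3, h4, h5, h6, h7, h8, h9, h10, h11, h12, h13, h14, h15, h16⟩ :=
    hM.ip_table hs
  let e := basisOfLinearIndependentOfCardEqFinrank (hM.linearIndependent hs) (by simp)
  have hv := e.sum_repr v
  generalize e.repr v = c at hv
  rw [Fin.sum_univ_four] at hv
  simp only [e, coe_basisOfLinearIndependentOfCardEqFinrank] at hv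
  change c 0 • γ s + c 1 • A s + c 2 • B s + c 3 • C s = v at hv
  rw [← hv]
  simp only [ip_add_left, ip_smul_left, h1, h2, h3, h4, h5, h6, h7, h8, h9, h10, h11, h12, h13,
    h14, h15, h16]
  module

/-! ### Derivatives of the trivectors of the frame -/

/-- This is `Q' = k₂ P + R`, the only derivative that the Laplacian of the Gauss map needs. -/
theorem hasDerivAt_alt_γCB (hM : IsCartanFrame I γ A B C k₁ k₂) (α : E42 [⋀^Fin 3]→ₗ[ℝ] ℝ)
    {s : ℝ} (hs : s ∈ I) : HasDerivAt (fun τ => α ![γ τ, C τ, B τ])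
      (k₂ * α ![γ s, A s, B s] + α ![A s, C s, B s]) s := by
  refine (HasDerivAt.alt α (hM.deriv_γ s hs) (hM.deriv_C s hs) (hM.deriv_B s hs)).congr_deriv ?_
  rw [show k₂ • C s - γ s = k₂ • C s + (-1 : ℝ) • γ s by module, alt_comb₁, alt_comb₂]
  simp only [alt_self₀₂, alt_self₁₂, smul_eq_mul]
  ring

/-- This is `H' = k₁ Q`: the two `γ ∧ A ∧ C` contributions, weighted by `k₂`, cancel. Since `k₁ >
0`, it shows that `H` is not constant. -/
theorem hasDerivAt_alt_γAB_add_ACB (hM : IsCartanFrame I γ A B C k₁ k₂)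
    (α : E42 [⋀^Fin 3]→ₗ[ℝ] ℝ) {s : ℝ} (hs : s ∈ I) :
    HasDerivAt (fun τ => α ![γ τ, A τ, B τ] + k₂ * α ![A τ, C τ, B τ])
      (k₁ s * α ![γ s, C s, B s]) s := by
  refine ((HasDerivAt.alt α (hM.deriv_γ s hs) (hM.deriv_A s hs) (hM.deriv_B s hs)).add
    ((HasDerivAt.alt α (hM.deriv_A s hs) (hM.deriv_C s hs) (hM.deriv_B s hs)).const_mul
      k₂)).congr_deriv ?_
  rw [show k₂ • C s - γ s = k₂ • C s + (-1 : ℝ) • γ s by module,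
    show k₁ s • C s = k₁ s • C s + (0 : ℝ) • C s by module]
  simp only [alt_comb₀, alt_comb₁, alt_comb₂, alt_self₀₁, alt_self₀₂, alt_self₁₂, smul_eq_mul]
  rw [alt_swap₁₂ α (A s) (γ s) (C s), alt_swap₀₁ α (γ s) (A s) (C s)]
  ring

end IsCartanFrame

/-! ### Ruled surfaces with null rulings: curvature and Laplacian -/

theorem isOpen_strip {I : Set ℝ} (hI : IsOpen I) : IsOpen (strip I) := hI.prod isOpen_univ

/-- A partial derivative in the first variable, for a function that agrees on `U` with `h`. -/
theorem pd_zero_of_eqOn {F : Type*} [NormedAddCommGroup F] [NormedSpace ℝ F] {f h : ℝ × ℝ → F}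
    {U : Set (ℝ × ℝ)} (hU : IsOpen U) (hf : ContDiffOn ℝ ∞ h U) (hfh : Set.EqOn f h U)
    {p : ℝ × ℝ} (hp : p ∈ U) {f' : F} (hd : HasDerivAt (fun s => h (s, p.2)) f' p.1) :
    pd 0 f p = f' := by
  rw [pd_congr hU hfh hp]
  have h1 : HasFDerivAt h (fderiv ℝ h p) (p.1, p.2) :=
    ((hf.contDiffAt (hU.mem_nhds hp)).differentiableAt (by simp)).hasFDerivAt
  exact (h1.comp_hasDerivAt p.1 ((hasDerivAt_id p.1).prodMk (hasDerivAt_const p.1 p.2))).unique hd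

/-- A partial derivative in the second variable, for a function that agrees on `U` with `h`. -/
theorem pd_one_of_eqOn {F : Type*} [NormedAddCommGroup F] [NormedSpace ℝ F] {f h : ℝ × ℝ → F}
    {U : Set (ℝ × ℝ)} (hU : IsOpen U) (hf : ContDiffOn ℝ ∞ h U) (hfh : Set.EqOn f h U)
    {p : ℝ × ℝ} (hp : p ∈ U) {f' : F} (hd : HasDerivAt (fun t => h (p.1, t)) f' p.2) :
    pd 1 f p = f' := by
  rw [pd_congr hU hfh hp]
  have h1 : HasFDerivAt h (fderiv ℝ h p) (p.1, p.2) :=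
    ((hf.contDiffAt (hU.mem_nhds hp)).differentiableAt (by simp)).hasFDerivAt
  exact (h1.comp_hasDerivAt p.2 ((hasDerivAt_const p.2 p.1).prodMk (hasDerivAt_id p.2))).unique hd

theorem contDiffOn_comp_fst {F : Type*} [NormedAddCommGroup F] [NormedSpace ℝ F] {I : Set ℝ}
    {h : ℝ → F} (hh : ContDiffOn ℝ ∞ h I) : ContDiffOn ℝ ∞ (fun p : ℝ × ℝ => h p.1) (strip I) :=
  hh.comp contDiffOn_fst fun _ hp => hp.1

/-- The partial derivatives of a function that is affine in the second variable. -/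
theorem pd_affine {F : Type*} [NormedAddCommGroup F] [NormedSpace ℝ F] {I : Set ℝ} (hI : IsOpen I)
    {f : ℝ × ℝ → F} {h₀ h₁ : ℝ → F} (hh₀ : ContDiffOn ℝ ∞ h₀ I) (hh₁ : ContDiffOn ℝ ∞ h₁ I)
    (hf : Set.EqOn f (fun p => h₀ p.1 + p.2 • h₁ p.1) (strip I)) {p : ℝ × ℝ} (hp : p ∈ strip I) :
    pd 0 f p = deriv h₀ p.1 + p.2 • deriv h₁ p.1 ∧ pd 1 f p = h₁ p.1 := by
  have hs : ContDiffOn ℝ ∞ (fun p : ℝ × ℝ => h₀ p.1 + p.2 • h₁ p.1) (strip I) :=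
    (contDiffOn_comp_fst hh₀).add (contDiffOn_snd.smul (contDiffOn_comp_fst hh₁))
  have hd : ∀ {h : ℝ → F}, ContDiffOn ℝ ∞ h I → HasDerivAt h (deriv h p.1) p.1 := fun hh =>
    ((hh.contDiffAt (hI.mem_nhds hp.1)).differentiableAt (by simp)).hasDerivAt
  refine ⟨pd_zero_of_eqOn (isOpen_strip hI) hs hf hp ((hd hh₀).add ((hd hh₁).const_smul p.2)),
    pd_one_of_eqOn (isOpen_strip hI) hs hf hp ?_⟩
  exact (((hasDerivAt_id p.2).smul_const (h₁ p.1)).const_add (h₀ p.1)).congr_deriv (one_smul _ _)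

/-- The metrics `(a + b t²) ds² - 2 w ds dt`, with `a` a function of `s`. -/
structure IsNullRuled (g : ℝ × ℝ → Matrix (Fin 2) (Fin 2) ℝ) (I : Set ℝ) (a : ℝ → ℝ)
    (b w : ℝ) : Prop where
  isOpen : IsOpen I
  smooth : ContDiffOn ℝ ∞ a I
  ne_zero : w ≠ 0
  eq : ∀ p ∈ strip I, g p = !![a p.1 + b * p.2 ^ 2, -w; -w, 0]

/-- The Christoffel symbols of the metric `(a + b t²) ds² - 2 w ds dt`. -/
def ruledChristoffel (a : ℝ → ℝ) (b w : ℝ) (p : ℝ × ℝ) : Fin 2 → Matrix (Fin 2) (Fin 2) ℝ :=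
  ![!![b * p.2 / w, 0; 0, 0],
    !![-deriv a p.1 / (2 * w) + (a p.1 + b * p.2 ^ 2) * (b * p.2) / w ^ 2, -(b * p.2 / w);
      -(b * p.2 / w), 0]]

namespace IsNullRuled

variable {g : ℝ × ℝ → Matrix (Fin 2) (Fin 2) ℝ} {I : Set ℝ} {a : ℝ → ℝ} {b w : ℝ}

theorem inv_eq (hg : IsNullRuled g I a b w) {p : ℝ × ℝ} (hp : p ∈ strip I) :
    (g p)⁻¹ = !![0, -(1 / w); -(1 / w), -((a p.1 + b * p.2 ^ 2) / w ^ 2)] := by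
  have hw := hg.ne_zero
  rw [hg.eq p hp]
  refine Matrix.inv_eq_right_inv ?_
  ext i j
  fin_cases i <;> fin_cases j <;> simp [Matrix.mul_apply, Fin.sum_univ_two]
  all_goals field_simp
  ring

theorem pd_entry (hg : IsNullRuled g I a b w) {p : ℝ × ℝ} (hp : p ∈ strip I) (i j l : Fin 2) :
    pd i (fun q => g q j l) p
      = if j = 0 ∧ l = 0 then (if i = 0 then deriv a p.1 else 2 * b * p.2) else 0 := by
  have hU := isOpen_strip hg.isOpen
  by_cases hjl : j = 0 ∧ l = 0
  · obtain ⟨rfl, rfl⟩ := hjl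
    have he : Set.EqOn (fun q => g q 0 0) (fun q => a q.1 + b * q.2 ^ 2) (strip I) := by
      intro q hq; simp [hg.eq q hq]
    have hs : ContDiffOn ℝ ∞ (fun q : ℝ × ℝ => a q.1 + b * q.2 ^ 2) (strip I) :=
      (contDiffOn_comp_fst hg.smooth).add (contDiffOn_const.mul (contDiffOn_snd.pow 2))
    have hd : HasDerivAt a (deriv a p.1) p.1 :=
      ((hg.smooth.contDiffAt (hg.isOpen.mem_nhds hp.1)).differentiableAt (by simp)).hasDerivAt
    fin_cases i
    · exact pd_zero_of_eqOn hU hs he hp (f' := deriv a p.1) (hd.add_const (b * p.2 ^ 2))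
    · refine pd_one_of_eqOn hU hs he hp ?_
      refine ((((hasDerivAt_id p.2).pow 2).const_mul b).const_add (a p.1)).congr_deriv ?_
      simp; ring
  · rw [if_neg hjl]
    have he : Set.EqOn (fun q => g q j l) (fun _ => g p j l) (strip I) := by
      intro q hq
      simp only [hg.eq q hq, hg.eq p hp]
      fin_cases j <;> fin_cases l <;> simp_all
    rw [pd_congr hU he hp]
    simp [pd]

theorem christoffel_eq (hg : IsNullRuled g I a b w) (k i j : Fin 2) :
    Set.EqOn (christoffel g k i j) (fun p => ruledChristoffel a b w p k i j) (strip I) := by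
  intro p hp
  have hw := hg.ne_zero
  simp only [christoffel, hg.pd_entry hp, hg.inv_eq hp, Fin.sum_univ_two, ruledChristoffel]
  fin_cases k <;> fin_cases i <;> fin_cases j <;> simp <;> field_simp

theorem isSmoothMetric (hg : IsNullRuled g I a b w) : IsSmoothMetric g (strip I) := by
  have ha : ContDiffOn ℝ ∞ (fun p : ℝ × ℝ => a p.1) (strip I) := contDiffOn_comp_fst hg.smooth
  have ha' : ContDiffOn ℝ ∞ (fun p : ℝ × ℝ => deriv a p.1) (strip I) :=
    contDiffOn_comp_fst ((contDiffOn_infty_iff_deriv_of_isOpen hg.isOpen).1 hg.smooth).2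
  have ht : ContDiffOn ℝ ∞ (fun p : ℝ × ℝ => b * p.2) (strip I) :=
    contDiffOn_const.mul contDiffOn_snd
  have hE : ContDiffOn ℝ ∞ (fun p : ℝ × ℝ => a p.1 + b * p.2 ^ 2) (strip I) :=
    ha.add (contDiffOn_const.mul (contDiffOn_snd.pow 2))
  refine ⟨isOpen_strip hg.isOpen, fun i j => ?_, fun k i j => ?_⟩
  · refine ContDiffOn.congr (f := fun p => !![0, -(1 / w); -(1 / w),
      -((a p.1 + b * p.2 ^ 2) / w ^ 2)] i j) ?_ fun p hp => by rw [hg.inv_eq hp]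
    fin_cases i <;> fin_cases j
    · exact contDiffOn_const
    · exact contDiffOn_const
    · exact contDiffOn_const
    · exact (hE.div_const _).neg
  · refine ContDiffOn.congr ?_ (hg.christoffel_eq k i j)
    fin_cases k <;> fin_cases i <;> fin_cases j
    · exact ht.div_const w
    · exact contDiffOn_const
    · exact contDiffOn_const
    · exact contDiffOn_const
    · exact (ha'.neg.div_const _).add ((hE.mul ht).div_const _)
    · exact (ht.div_const w).neg
    · exact (ht.div_const w).neg
    · exact contDiffOn_const

/-- The Laplacian of a function that is affine along the rulings. -/
theorem laplacian_affine (hg : IsNullRuled g I a b w) {f : ℝ × ℝ → ℝ} {h₀ h₁ : ℝ → ℝ}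
    (hh₀ : ContDiffOn ℝ ∞ h₀ I) (hh₁ : ContDiffOn ℝ ∞ h₁ I)
    (hf : Set.EqOn f (fun p => h₀ p.1 + p.2 * h₁ p.1) (strip I)) {p : ℝ × ℝ} (hp : p ∈ strip I) :
    laplacian g f p = 2 / w * deriv h₁ p.1 + 2 * b * p.2 / w ^ 2 * h₁ p.1 := by
  have hw := hg.ne_zero
  have hder : ∀ {h : ℝ → ℝ}, ContDiffOn ℝ ∞ h I → ContDiffOn ℝ ∞ (deriv h) I := fun hh =>
    ((contDiffOn_infty_iff_deriv_of_isOpen hg.isOpen).1 hh).2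
  have h1 := fun q (hq : q ∈ strip I) => pd_affine hg.isOpen hh₀ hh₁ hf hq
  have h2 := pd_affine hg.isOpen (hder hh₀) (hder hh₁) (f := pd 0 f) (fun q hq => (h1 q hq).1) hp
  have h3 := pd_affine hg.isOpen hh₁ (contDiffOn_const (c := (0 : ℝ))) (f := pd 1 f)
    (fun q hq => by rw [(h1 q hq).2]; simp) hp
  simp only [laplacian, hg.inv_eq hp, hg.christoffel_eq _ _ _ hp, Fin.sum_univ_two,
    ruledChristoffel, (h1 p hp).2, h2.2, h3.1, h3.2]
  simp
  field_simp
  ring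

/-- The coefficient `b` of `t²` carries the whole curvature. When `b = 0`, the only Christoffel
symbol left is a function of `s` with upper index `1` and lower indices `0, 0`, which contributes
nothing. -/
theorem riemann_eq_zero_iff (hg : IsNullRuled g I a b w) (hI : I.Nonempty) :
    (∀ p ∈ strip I, ∀ l k i j : Fin 2, riemann g l k i j p = 0) ↔ b = 0 := by
  have hU := isOpen_strip hg.isOpen
  have hw := hg.ne_zero
  have hR : ∀ p ∈ strip I, ∀ l k i j : Fin 2, riemann g l k i j p
      = pd i (fun q => ruledChristoffel a b w q l j k) p
        - pd j (fun q => ruledChristoffel a b w q l i k) p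
        + ∑ m, (ruledChristoffel a b w p l i m * ruledChristoffel a b w p m j k
          - ruledChristoffel a b w p l j m * ruledChristoffel a b w p m i k) := by
    intro p hp l k i j
    rw [riemann, pd_congr hU (hg.christoffel_eq l j k) hp, pd_congr hU (hg.christoffel_eq l i k) hp]
    simp only [hg.christoffel_eq _ _ _ hp]
  have hconst : ∀ (c : ℝ) (i : Fin 2) (p : ℝ × ℝ), pd i (fun _ => c) p = 0 := by
    intro c i p; simp [pd]
  constructor
  · intro h
    obtain ⟨s, hs⟩ := hI
    have hp : (s, (0 : ℝ)) ∈ strip I := ⟨hs, trivial⟩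
    -- At `t = 0` this component reduces to `-∂_t (b t / w) = -b / w`.
    have h0 := h _ hp 0 0 0 1
    rw [hR _ hp] at h0
    have hd : pd 1 (fun q : ℝ × ℝ => b * q.2 / w) (s, (0 : ℝ)) = b / w := by
      refine pd_one_of_eqOn hU ((contDiffOn_const.mul contDiffOn_snd).div_const w)
        (fun _ _ => rfl) hp ?_
      exact (((hasDerivAt_id (0 : ℝ)).const_mul b).div_const w).congr_deriv (by simp)
    simp [ruledChristoffel, hconst, hd] at h0
    exact h0.resolve_right hw
  · rintro rfl p hp l k i j
    have hd : pd 1 (fun q : ℝ × ℝ => -deriv a q.1 / (2 * w)) p = 0 := by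
      refine pd_one_of_eqOn hU ?_ (fun _ _ => rfl) hp
        (hasDerivAt_const p.2 (-deriv a p.1 / (2 * w)))
      exact contDiffOn_comp_fst (h := fun s => -deriv a s / (2 * w))
        (((contDiffOn_infty_iff_deriv_of_isOpen hg.isOpen).1 hg.smooth).2.neg.div_const _)
    rw [hR p hp]
    fin_cases l <;> fin_cases k <;> fin_cases i <;> fin_cases j <;>
      simp [ruledChristoffel, hconst, hd]

end IsNullRuled

/-! ### The parallel surfaces of a B-scroll -/

namespace IsCartanFrame

variable {I : Set ℝ} {γ A B C : ℝ → E42} {k₁ : ℝ → ℝ} {k₂ : ℝ}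

/-- `x` is the ruled surface with base curve `a γ + b C` and rulings along `B`, in the
parametrization that a parallel surface of the B-scroll over `γ` inherits. -/
def IsParallelScroll (γ B C : ℝ → E42) (k₂ : ℝ) (I : Set ℝ) (a b : ℝ) (x : ℝ × ℝ → E42) : Prop :=
  Set.EqOn x (fun p => (a • γ p.1 + b • C p.1) + (p.2 * (a + b * k₂)) • B p.1) (strip I)

theorem contDiffOn_parallelScroll (hM : IsCartanFrame I γ A B C k₁ k₂) {a b : ℝ}
    {x : ℝ × ℝ → E42} (hx : IsParallelScroll γ B C k₂ I a b x) :
    ContDiffOn ℝ ∞ x (strip I) :=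
  ContDiffOn.congr (((contDiffOn_comp_fst hM.smooth_γ).const_smul a).add
    ((contDiffOn_comp_fst hM.smooth_C).const_smul b) |>.add
      ((contDiffOn_snd.mul contDiffOn_const).smul (contDiffOn_comp_fst hM.smooth_B))) hx

theorem pd_parallelScroll (hM : IsCartanFrame I γ A B C k₁ k₂) {a b : ℝ} {x : ℝ × ℝ → E42}
    (hx : IsParallelScroll γ B C k₂ I a b x) {p : ℝ × ℝ} (hp : p ∈ strip I) :
    pd 0 x p = ((a + b * k₂) • A p.1 + (b * k₁ p.1) • B p.1)
        + (p.2 * (a + b * k₂)) • (k₂ • C p.1 - γ p.1) ∧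
      pd 1 x p = (a + b * k₂) • B p.1 := by
  have h := pd_affine hM.isOpen (f := x) (h₀ := fun s => a • γ s + b • C s)
    (h₁ := fun s => (a + b * k₂) • B s)
    ((hM.smooth_γ.const_smul a).add (hM.smooth_C.const_smul b)) (hM.smooth_B.const_smul _)
    (fun q hq => by rw [hx hq]; simp only [smul_smul]) hp
  refine ⟨?_, h.2⟩
  have h₀ : deriv (fun s => a • γ s + b • C s) p.1 = _ :=
    (((hM.deriv_γ _ hp.1).const_smul a).add ((hM.deriv_C _ hp.1).const_smul b)).deriv
  have h₁ : deriv (fun s => (a + b * k₂) • B s) p.1 = _ :=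
    ((hM.deriv_B _ hp.1).const_smul (a + b * k₂)).deriv
  rw [h.1, h₀, h₁]
  module

/-- The rulings are null, which gives the zero entry and the determinant `-m⁴`: the surface is
Lorentzian as soon as `m ≠ 0`. -/
theorem metric_parallelScroll (hM : IsCartanFrame I γ A B C k₁ k₂) {a b : ℝ} {x : ℝ × ℝ → E42}
    (hx : IsParallelScroll γ B C k₂ I a b x) {p : ℝ × ℝ} (hp : p ∈ strip I) :
    metric x p = !![-(2 * (a + b * k₂) * b) * k₁ p.1
        + (a + b * k₂) ^ 2 * (k₂ ^ 2 - 1) * p.2 ^ 2, -(a + b * k₂) ^ 2; -(a + b * k₂) ^ 2, 0] := by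
  obtain ⟨h1, h2, h3, h4, h5, h6, h7, h8, h9, h10, h11, h12, h13, h14, h15, h16⟩ :=
    hM.ip_table hp.1
  obtain ⟨e0, e1⟩ := hM.pd_parallelScroll hx hp
  ext i j
  fin_cases i <;> fin_cases j <;>
    simp only [metric, Matrix.of_apply, Fin.zero_eta, Fin.mk_one, e0, e1, ip_add_left, ip_sub_left,
      ip_smul_left, ip_add_right, ip_sub_right, ip_smul_right, h1, h2, h3, h4, h5, h6, h7, h8, h9,
      h10, h11, h12, h13, h14, h15, h16, Matrix.cons_val', Matrix.cons_val_zero,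
      Matrix.cons_val_one, Matrix.cons_val_fin_one] <;> ring

theorem isNullRuled_parallelScroll (hM : IsCartanFrame I γ A B C k₁ k₂) {a b : ℝ}
    {x : ℝ × ℝ → E42} (hx : IsParallelScroll γ B C k₂ I a b x) (hm : a + b * k₂ ≠ 0) :
    IsNullRuled (metric x) I (fun s => -(2 * (a + b * k₂) * b) * k₁ s)
      ((a + b * k₂) ^ 2 * (k₂ ^ 2 - 1)) ((a + b * k₂) ^ 2) :=
  ⟨hM.isOpen, contDiffOn_const.mul hM.contDiffOn_k₁, pow_ne_zero 2 hm,
    fun _ hp => hM.metric_parallelScroll hx hp⟩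

theorem isLorentzSurface_parallelScroll (hM : IsCartanFrame I γ A B C k₁ k₂) {a b : ℝ}
    (hab : a ^ 2 - b ^ 2 = 1) {x : ℝ × ℝ → E42} (hx : IsParallelScroll γ B C k₂ I a b x)
    (hm : a + b * k₂ ≠ 0) : IsLorentzSurface x (strip I) := by
  refine ⟨hM.contDiffOn_parallelScroll hx, fun p hp => ?_, fun p hp => ?_⟩
  · obtain ⟨h1, h2, h3, h4, h5, h6, h7, h8, h9, h10, h11, h12, h13, h14, h15, h16⟩ :=
      hM.ip_table hp.1
    simp only [H31, Set.mem_ofPred_eq, hx hp, ip_add_left, ip_smul_left, ip_add_right,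
      ip_smul_right, h1, h3, h4, h7, h8, h9, h10, h15, h16]
    linear_combination -hab
  · rw [hM.metric_parallelScroll hx hp, Matrix.det_fin_two_of]
    have : 0 < (a + b * k₂) ^ 2 * (a + b * k₂) ^ 2 := by positivity
    linarith

theorem isFlat_parallelScroll_iff (hM : IsCartanFrame I γ A B C k₁ k₂) {a b : ℝ}
    {x : ℝ × ℝ → E42} (hx : IsParallelScroll γ B C k₂ I a b x) (hm : a + b * k₂ ≠ 0) :
    IsFlat x (strip I) ↔ k₂ ^ 2 - 1 = 0 := by
  rw [IsFlat, (hM.isNullRuled_parallelScroll hx hm).riemann_eq_zero_iff hM.nonempty, mul_eq_zero,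
    or_iff_right (pow_ne_zero 2 hm)]

/-! ### The type of the Gauss map -/

/-- The third factor is `m B`, so multiples of `B` in the other two drop out. What remains is `(a γ
+ b C) ∧ m (A + t (k₂ C - γ)) ∧ m B`, and the area factor is `m²`. -/
theorem gaussMap_parallelScroll (hM : IsCartanFrame I γ A B C k₁ k₂) {a b : ℝ}
    {x : ℝ × ℝ → E42} (hx : IsParallelScroll γ B C k₂ I a b x) (hm : a + b * k₂ ≠ 0)
    {p : ℝ × ℝ} (hp : p ∈ strip I) :
    gaussMap x p = (a • exteriorPower.ιMulti ℝ 3 ![γ p.1, A p.1, B p.1]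
        - b • exteriorPower.ιMulti ℝ 3 ![A p.1, C p.1, B p.1])
      + (p.2 * (b + a * k₂)) • exteriorPower.ιMulti ℝ 3 ![γ p.1, C p.1, B p.1] := by
  have hdet : √|(metric x p).det| = (a + b * k₂) ^ 2 := by
    rw [hM.metric_parallelScroll hx hp, Matrix.det_fin_two_of, mul_zero, zero_sub, abs_neg,
      neg_mul_neg, abs_mul_self, Real.sqrt_mul_self (sq_nonneg _)]
  obtain ⟨e0, e1⟩ := hM.pd_parallelScroll hx hp
  rw [gaussMap, hdet, e0, e1, hx hp]
  beta_reduce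
  generalize exteriorPower.ιMulti ℝ 3 (M := E42) = α
  generalize γ p.1 = g, A p.1 = A', B p.1 = B', C p.1 = C', p.2 = t
  have hB : ∀ u v : E42, α ![u, v, (a + b * k₂) • B'] = (a + b * k₂) • α ![u, v, B'] := by
    intro u v
    have h := alt_comb₂ α (a + b * k₂) 0 B' 0 u v
    simpa using h
  have h₀ : ∀ (v : E42) (r : ℝ) (u : E42), α ![u + r • B', v, B'] = α ![u, v, B'] := by
    intro v r u
    have h := alt_comb₀ α 1 r u B' v B'
    rwa [alt_self₀₂, one_smul, one_smul, smul_zero, add_zero] at h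
  have h₁ : ∀ (u v : E42) (r : ℝ), α ![u, v + r • B', B'] = α ![u, v, B'] := by
    intro u v r
    have h := alt_comb₁ α 1 r v B' u B'
    rwa [alt_self₁₂, one_smul, one_smul, smul_zero, add_zero] at h
  rw [hB, h₀, show (a + b * k₂) • A' + (b * k₁ p.1) • B' + (t * (a + b * k₂)) • (k₂ • C' - g)
    = (a + b * k₂) • ((1 : ℝ) • A' + t • (k₂ • C' + (-1 : ℝ) • g)) + (b * k₁ p.1) • B' by module,
    h₁]
  have h₂ : ∀ u v : E42, α ![u, (a + b * k₂) • v, B'] = (a + b * k₂) • α ![u, v, B'] := by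
    intro u v
    have h := alt_comb₁ α (a + b * k₂) 0 v 0 u B'
    simpa using h
  rw [h₂, smul_smul, smul_smul, mul_assoc, ← pow_two, inv_mul_cancel₀ (pow_ne_zero 2 hm), one_smul]
  simp only [alt_comb₀, alt_comb₁, alt_self₀₁]
  rw [alt_swap₀₁ α g C' B', alt_swap₀₁ α A' C' B']
  module

/-- The trivector field `γ ∧ A ∧ B + k₂ A ∧ C ∧ B` along the curve. Up to a factor, it is the
harmonic part of the Gauss map of the B-scroll and of its parallel surfaces. -/
def harmonicPart (γ A B C : ℝ → E42) (k₂ : ℝ) (s : ℝ) : ⋀[ℝ]^3 E42 :=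
  exteriorPower.ιMulti ℝ 3 ![γ s, A s, B s] + k₂ • exteriorPower.ιMulti ℝ 3 ![A s, C s, B s]

theorem contDiffOn_dual_ιMulti (ℓ : Module.Dual ℝ (⋀[ℝ]^3 E42)) {u v w : ℝ → E42}
    (hu : ContDiffOn ℝ ∞ u I) (hv : ContDiffOn ℝ ∞ v I) (hw : ContDiffOn ℝ ∞ w I) :
    ContDiffOn ℝ ∞ (fun s => ℓ (exteriorPower.ιMulti ℝ 3 ![u s, v s, w s])) I :=
  ContDiffOn.alt (ℓ.compAlternatingMap (exteriorPower.ιMulti ℝ 3)) hu hv hw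

/-- Wedging with the missing frame vector reads off a trivector coefficient, because the determinant
of the frame is nonzero. The next two lemmas separate `P` and `R` in the same way. -/
theorem exists_dual_γCB_ne_zero (hM : IsCartanFrame I γ A B C k₁ k₂) {s : ℝ} (hs : s ∈ I) :
    ∃ ℓ : Module.Dual ℝ (⋀[ℝ]^3 E42), ℓ (exteriorPower.ιMulti ℝ 3 ![γ s, C s, B s]) ≠ 0 := by
  obtain ⟨ℓ, hℓ⟩ := exists_dual_det (A s)
  refine ⟨ℓ, ?_⟩
  rw [hℓ]
  convert hM.det_ne_zero hs ![1, 0, 3, 2] (by decide) using 3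
  ext i : 1
  fin_cases i <;> rfl

theorem exists_dual_γAB (hM : IsCartanFrame I γ A B C k₁ k₂) {s : ℝ} (hs : s ∈ I) :
    ∃ ℓ : Module.Dual ℝ (⋀[ℝ]^3 E42), ℓ (exteriorPower.ιMulti ℝ 3 ![γ s, A s, B s]) ≠ 0 ∧
      ℓ (exteriorPower.ιMulti ℝ 3 ![A s, C s, B s]) = 0 := by
  obtain ⟨ℓ, hℓ⟩ := exists_dual_det (C s)
  refine ⟨ℓ, ?_, ?_⟩
  · rw [hℓ]
    convert hM.det_ne_zero hs ![3, 0, 1, 2] (by decide) using 3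
    ext i : 1
    fin_cases i <;> rfl
  · rw [hℓ]
    exact Matrix.det_zero_of_row_eq (i := 0) (j := 2) (by decide) rfl

theorem exists_dual_ACB (hM : IsCartanFrame I γ A B C k₁ k₂) {s : ℝ} (hs : s ∈ I) :
    ∃ ℓ : Module.Dual ℝ (⋀[ℝ]^3 E42), ℓ (exteriorPower.ιMulti ℝ 3 ![A s, C s, B s]) ≠ 0 ∧
      ℓ (exteriorPower.ιMulti ℝ 3 ![γ s, A s, B s]) = 0 := by
  obtain ⟨ℓ, hℓ⟩ := exists_dual_det (γ s)
  refine ⟨ℓ, ?_, ?_⟩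
  · rw [hℓ]
    convert hM.det_ne_zero hs ![0, 1, 3, 2] (by decide) using 3
    ext i : 1
    fin_cases i <;> rfl
  · rw [hℓ]
    exact Matrix.det_zero_of_row_eq (i := 0) (j := 1) (by decide) rfl

theorem harmonicPart_nonconst (hM : IsCartanFrame I γ A B C k₁ k₂) :
    ∃ s ∈ I, ∃ r ∈ I, harmonicPart γ A B C k₂ s ≠ harmonicPart γ A B C k₂ r := by
  by_contra! h
  obtain ⟨s, hs⟩ := hM.nonempty
  obtain ⟨ℓ, hℓ⟩ := hM.exists_dual_γCB_ne_zero hs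
  have hd := hM.hasDerivAt_alt_γAB_add_ACB (ℓ.compAlternatingMap (exteriorPower.ιMulti ℝ 3)) hs
  have h0 : HasDerivAt (fun _ : ℝ => ℓ (harmonicPart γ A B C k₂ s)) 0 s := hasDerivAt_const _ _
  have h1 := h0.unique (hd.congr_of_eventuallyEq ?_)
  · exact mul_ne_zero (hM.k₁_pos s hs).ne' hℓ h1.symm
  · filter_upwards [hM.isOpen.mem_nhds hs] with r hr
    rw [h s hs r hr, harmonicPart, map_add, map_smul]
    rfl

/-- The Laplacian of a map `u + t n (γ ∧ C ∧ B)` with `u` a function of `s`. -/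
theorem laplacian_parallelScroll (hM : IsCartanFrame I γ A B C k₁ k₂) {a b : ℝ}
    {x : ℝ × ℝ → E42} (hx : IsParallelScroll γ B C k₂ I a b x) (hm : a + b * k₂ ≠ 0)
    (ℓ : Module.Dual ℝ (⋀[ℝ]^3 E42)) {f : ℝ × ℝ → ℝ} {u : ℝ → ℝ} {n : ℝ}
    (hu : ContDiffOn ℝ ∞ u I) (hf : Set.EqOn f (fun p => u p.1
      + p.2 * (n * ℓ (exteriorPower.ιMulti ℝ 3 ![γ p.1, C p.1, B p.1]))) (strip I)) :
    ContDiffOn ℝ ∞ f (strip I) ∧ ∀ p ∈ strip I, laplacian (metric x) f p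
      = 2 * n / (a + b * k₂) ^ 2 * (k₂ * ℓ (exteriorPower.ιMulti ℝ 3 ![γ p.1, A p.1, B p.1])
          + ℓ (exteriorPower.ιMulti ℝ 3 ![A p.1, C p.1, B p.1]))
        + 2 * (k₂ ^ 2 - 1) / (a + b * k₂) ^ 2
          * (p.2 * n * ℓ (exteriorPower.ιMulti ℝ 3 ![γ p.1, C p.1, B p.1])) := by
  have hQ : ContDiffOn ℝ ∞
      (fun s => n * ℓ (exteriorPower.ιMulti ℝ 3 ![γ s, C s, B s])) I :=
    contDiffOn_const.mul (contDiffOn_dual_ιMulti ℓ hM.smooth_γ hM.smooth_C hM.smooth_B)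
  refine ⟨ContDiffOn.congr ((contDiffOn_comp_fst hu).add
    (contDiffOn_snd.mul (contDiffOn_comp_fst hQ))) hf, fun p hp => ?_⟩
  rw [(hM.isNullRuled_parallelScroll hx hm).laplacian_affine hu hQ hf hp]
  have hd := (hM.hasDerivAt_alt_γCB (ℓ.compAlternatingMap (exteriorPower.ιMulti ℝ 3))
    hp.1).const_mul n
  simp only [LinearMap.compAlternatingMap_apply] at hd
  rw [hd.deriv]
  field_simp

/-- The rigidity criterion applies with `Δ G = lam G + (2 / m) H`. For `k₂² = 1` it says that no
spectral decomposition exists. -/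
theorem gaussMap_spectral (hM : IsCartanFrame I γ A B C k₁ k₂) {a b : ℝ}
    {x : ℝ × ℝ → E42} (hx : IsParallelScroll γ B C k₂ I a b x)
    (hm : a + b * k₂ ≠ 0) (hn : b + a * k₂ ≠ 0) {k : ℕ} {μ : Fin k → ℝ}
    {ψ : Fin k → ℝ × ℝ → ⋀[ℝ]^3 E42}
    (h : IsSpectralDecomposition (metric x) (strip I) (gaussMap x) μ ψ) :
    k₂ ^ 2 - 1 ≠ 0 ∧ k = 2 ∧ ∃ i, μ i = 0 := by
  set m := a + b * k₂ with hm_def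
  set n := b + a * k₂ with hn_def
  obtain ⟨s₀, hs₀⟩ := hM.nonempty
  have hp₀ : (s₀, (0 : ℝ)) ∈ strip I := ⟨hs₀, trivial⟩
  have hP := fun ℓ => contDiffOn_dual_ιMulti (I := I) ℓ hM.smooth_γ hM.smooth_A hM.smooth_B
  have hR := fun ℓ => contDiffOn_dual_ιMulti (I := I) ℓ hM.smooth_A hM.smooth_C hM.smooth_B
  have hG := fun p (hp : p ∈ strip I) => hM.gaussMap_parallelScroll hx hm hp
  have hL := fun ℓ => hM.laplacian_parallelScroll hx hm ℓ (f := fun p => ℓ (gaussMap x p))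
    (u := fun s => a * ℓ (exteriorPower.ιMulti ℝ 3 ![γ s, A s, B s])
      - b * ℓ (exteriorPower.ιMulti ℝ 3 ![A s, C s, B s])) (n := n)
    ((contDiffOn_const.mul (hP ℓ)).sub (contDiffOn_const.mul (hR ℓ)))
    (fun p hp => by
      simp only [hG p hp, map_add, map_sub, map_smul, smul_eq_mul, ← hn_def]; ring)
  have hφ' : ∀ p ∈ strip I, (2 * (k₂ ^ 2 - 1) / m ^ 2) • gaussMap x p
      + (2 / m) • harmonicPart γ A B C k₂ p.1
      = (2 * n / m ^ 2) • (k₂ • exteriorPower.ιMulti ℝ 3 ![γ p.1, A p.1, B p.1]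
          + exteriorPower.ιMulti ℝ 3 ![A p.1, C p.1, B p.1])
        + (2 * (k₂ ^ 2 - 1) / m ^ 2 * (p.2 * n))
          • exteriorPower.ιMulti ℝ 3 ![γ p.1, C p.1, B p.1] := by
    intro p hp
    rw [hG p hp, harmonicPart]
    match_scalars <;> field_simp
    · linear_combination hm_def - k₂ * hn_def
    · linear_combination k₂ * hm_def - hn_def
    · linear_combination -((k₂ ^ 2 - 1) * p.2) * hn_def
  have hrig := h.rigid (hM.isNullRuled_parallelScroll hx hm).isSmoothMetric
    (lam := 2 * (k₂ ^ 2 - 1) / m ^ 2)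
    (φ' := fun p => (2 * (k₂ ^ 2 - 1) / m ^ 2) • gaussMap x p
      + (2 / m) • harmonicPart γ A B C k₂ p.1)
    (fun ℓ => (hL ℓ).1) ?_ ?_ ?_ ?_
  · exact ⟨fun h0 => hrig.1 (by rw [h0]; simp), hrig.2⟩
  · intro ℓ p hp
    simp only [(hL ℓ).2 p hp, hφ' p hp, map_add, map_smul, smul_eq_mul, ← hm_def]
    ring
  · intro ℓ p hp
    have hu : ContDiffOn ℝ ∞ (fun s => 2 / m * (ℓ (exteriorPower.ιMulti ℝ 3 ![γ s, A s, B s])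
        + k₂ * ℓ (exteriorPower.ιMulti ℝ 3 ![A s, C s, B s]))) I :=
      contDiffOn_const.mul ((hP ℓ).add (contDiffOn_const.mul (hR ℓ)))
    -- `(Δ - lam) G = (2 / m) H` is constant along the rulings, the case `n := 0`, and hence
    -- harmonic.
    rw [(hM.laplacian_parallelScroll hx hm ℓ (n := 0) hu ?_).2 p hp]
    · simp
    · intro q hq
      simp only [harmonicPart, add_sub_cancel_left, map_smul, map_add, smul_eq_mul]
      ring
  -- At `t = 0` the coefficient of `R` in `Δ G` is `2 n / m² ≠ 0`.
  · refine ⟨_, hp₀, fun h0 => ?_⟩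
    rw [hφ' _ hp₀] at h0
    obtain ⟨ℓ, hℓ, hℓ'⟩ := hM.exists_dual_ACB hs₀
    have h1 := congrArg ℓ h0
    simp [hℓ, hℓ', hm, hn] at h1
  -- The coefficient of `P` in `(Δ - lam) G` is `2 / m ≠ 0`.
  · refine ⟨_, hp₀, fun h0 => ?_⟩
    obtain ⟨ℓ, hℓ, hℓ'⟩ := hM.exists_dual_γAB hs₀
    have h1 := congrArg ℓ (add_eq_left.1 h0)
    simp [harmonicPart, hℓ, hℓ', hm] at h1

theorem exists_gaussMap_spectral (hM : IsCartanFrame I γ A B C k₁ k₂) {a b : ℝ}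
    {x : ℝ × ℝ → E42} (hx : IsParallelScroll γ B C k₂ I a b x)
    (hm : a + b * k₂ ≠ 0) (hn : b + a * k₂ ≠ 0) (hk : k₂ ^ 2 - 1 ≠ 0) :
    ∃ (μ : Fin 2 → ℝ) (ψ : Fin 2 → ℝ × ℝ → ⋀[ℝ]^3 E42),
      IsSpectralDecomposition (metric x) (strip I) (gaussMap x) μ ψ ∧ ∃ i, μ i = 0 := by
  set m := a + b * k₂ with hm_def
  set n := b + a * k₂ with hn_def
  set β := k₂ ^ 2 - 1 with hβ
  obtain ⟨s₀, hs₀⟩ := hM.nonempty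
  have hP := fun ℓ => contDiffOn_dual_ιMulti (I := I) ℓ hM.smooth_γ hM.smooth_A hM.smooth_B
  have hR := fun ℓ => contDiffOn_dual_ιMulti (I := I) ℓ hM.smooth_A hM.smooth_C hM.smooth_B
  have hG := fun p (hp : p ∈ strip I) => hM.gaussMap_parallelScroll hx hm hp
  -- With `lam = 2 β / m²`, the multiple `m / β` solves `lam (m / β) = 2 / m`, so `Δ (G + (m / β) H)
  -- = lam (G + (m / β) H)`.
  refine ⟨![0, 2 * β / m ^ 2], ![fun p => (-(m / β)) • harmonicPart γ A B C k₂ p.1,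
    fun p => gaussMap x p + (m / β) • harmonicPart γ A B C k₂ p.1], ⟨?_, ?_, ?_, ?_⟩, 0, rfl⟩
  · have hne : 2 * β / m ^ 2 ≠ 0 := div_ne_zero (mul_ne_zero two_ne_zero hk) (pow_ne_zero 2 hm)
    intro i j hij
    fin_cases i <;> fin_cases j
    · rfl
    · exact (hne hij.symm).elim
    · exact (hne hij).elim
    · rfl
  · intro i
    fin_cases i
    · obtain ⟨s, hs, r, hr, hne⟩ := hM.harmonicPart_nonconst
      refine ⟨(s, 0), ⟨hs, trivial⟩, (r, 0), ⟨hr, trivial⟩, fun h => hne ?_⟩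
      exact smul_right_injective _ (neg_ne_zero.2 (div_ne_zero hm hk)) h
    -- Along a ruling the second summand varies by multiples of `n Q`, which is not zero.
    · refine ⟨(s₀, 1), ⟨hs₀, trivial⟩, (s₀, 0), ⟨hs₀, trivial⟩, fun h => ?_⟩
      have h' : gaussMap x (s₀, 1) = gaussMap x (s₀, 0) := add_right_cancel h
      rw [hG _ ⟨hs₀, trivial⟩, hG _ ⟨hs₀, trivial⟩] at h'
      obtain ⟨ℓ, hℓ⟩ := hM.exists_dual_γCB_ne_zero hs₀
      have h1 := congrArg ℓ (add_left_cancel h')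
      simp [hℓ, ← hn_def, hn] at h1
  · intro i ℓ
    fin_cases i
    · have hL := hM.laplacian_parallelScroll hx hm ℓ
        (f := fun p => ℓ ((-(m / β)) • harmonicPart γ A B C k₂ p.1)) (n := 0)
        (u := fun s => -(m / β) * (ℓ (exteriorPower.ιMulti ℝ 3 ![γ s, A s, B s])
          + k₂ * ℓ (exteriorPower.ιMulti ℝ 3 ![A s, C s, B s])))
        (contDiffOn_const.mul ((hP ℓ).add (contDiffOn_const.mul (hR ℓ))))
        (fun p hp => by
          simp only [harmonicPart, map_smul, map_add, smul_eq_mul]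
          ring)
      exact ⟨hL.1, fun p hp => (hL.2 p hp).trans (by simp)⟩
    · have hL := hM.laplacian_parallelScroll hx hm ℓ
        (f := fun p => ℓ (gaussMap x p + (m / β) • harmonicPart γ A B C k₂ p.1)) (n := n)
        (u := fun s => a * ℓ (exteriorPower.ιMulti ℝ 3 ![γ s, A s, B s])
          - b * ℓ (exteriorPower.ιMulti ℝ 3 ![A s, C s, B s])
          + m / β * (ℓ (exteriorPower.ιMulti ℝ 3 ![γ s, A s, B s])
          + k₂ * ℓ (exteriorPower.ιMulti ℝ 3 ![A s, C s, B s])))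
        (((contDiffOn_const.mul (hP ℓ)).sub (contDiffOn_const.mul (hR ℓ))).add
          (contDiffOn_const.mul ((hP ℓ).add (contDiffOn_const.mul (hR ℓ)))))
        (fun p hp => by
          simp only [hG p hp, harmonicPart, map_add, map_sub, map_smul, smul_eq_mul, ← hn_def]
          ring)
      refine ⟨hL.1, fun p hp => (hL.2 p hp).trans ?_⟩
      simp only [hG p hp, harmonicPart, map_add, map_sub, map_smul, smul_eq_mul, ← hn_def,
        ← hm_def, Fin.mk_one, Matrix.cons_val_one, Matrix.cons_val_fin_one, ← hβ]
      generalize ℓ (exteriorPower.ιMulti ℝ 3 ![γ p.1, A p.1, B p.1]) = P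
      generalize ℓ (exteriorPower.ιMulti ℝ 3 ![A p.1, C p.1, B p.1]) = R
      field_simp
      rw [hβ, hm_def, hn_def]
      ring
  · intro p hp
    rw [Fin.sum_univ_two]
    simp only [Matrix.cons_val_zero, Matrix.cons_val_one, Matrix.cons_val_fin_one]
    module

theorem gaussIsKType_iff (hM : IsCartanFrame I γ A B C k₁ k₂) {a b : ℝ}
    {x : ℝ × ℝ → E42} (hx : IsParallelScroll γ B C k₂ I a b x)
    (hm : a + b * k₂ ≠ 0) (hn : b + a * k₂ ≠ 0) (k : ℕ) :
    (GaussIsKType x (strip I) k ↔ k₂ ^ 2 - 1 ≠ 0 ∧ k = 2) ∧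
      (GaussIsNullKType x (strip I) k ↔ k₂ ^ 2 - 1 ≠ 0 ∧ k = 2) := by
  refine ⟨⟨?_, ?_⟩, ⟨?_, ?_⟩⟩
  · rintro ⟨-, μ, ψ, h⟩
    have := hM.gaussMap_spectral hx hm hn h
    exact ⟨this.1, this.2.1⟩
  · rintro ⟨hk, rfl⟩
    obtain ⟨μ, ψ, h, -⟩ := hM.exists_gaussMap_spectral hx hm hn hk
    exact ⟨by norm_num, μ, ψ, h⟩
  · rintro ⟨-, μ, ψ, h, -⟩
    have := hM.gaussMap_spectral hx hm hn h
    exact ⟨this.1, this.2.1⟩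
  · rintro ⟨hk, rfl⟩
    exact ⟨by norm_num, hM.exists_gaussMap_spectral hx hm hn hk⟩

/-! ### Unit normal fields and parallel surfaces -/

theorem isParallelScroll_scroll (γ B C : ℝ → E42) (k₂ : ℝ) (I : Set ℝ) :
    IsParallelScroll γ B C k₂ I 1 0 (scroll γ B) := fun p _ => by
  simp [scroll]

/-- Orthogonality to `x_t`, `x` and `x_s` determines in turn the products of `N` with `B`, `γ` and
`A`. Only `⟨N, C⟩` remains, and its square is 1. -/
theorem exists_normal_eq (hM : IsCartanFrame I γ A B C k₁ k₂) {N : ℝ × ℝ → E42}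
    (hN : IsUnitNormal (scroll γ B) N (strip I)) :
    ∃ e : ℝ, e ^ 2 = 1 ∧
      Set.EqOn N (fun p => e • (C p.1 + (k₂ * p.2) • B p.1)) (strip I) := by
  have hpd := fun p (hp : p ∈ strip I) =>
    hM.pd_parallelScroll (isParallelScroll_scroll γ B C k₂ I) hp
  have hform : ∀ p ∈ strip I, N p = ip (N p) (C p.1) • (C p.1 + (k₂ * p.2) • B p.1) := by
    intro p hp
    have h0 := hN.tangent p hp
    have h1 := hN.normal p hp 0
    have h2 := hN.normal p hp 1
    rw [(hpd p hp).1] at h1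
    rw [(hpd p hp).2] at h2
    simp only [scroll, ip_add_right, ip_sub_right, ip_smul_right] at h0 h1 h2
    have hB : ip (N p) (B p.1) = 0 := by linarith
    rw [hB] at h0 h1
    have hγ : ip (N p) (γ p.1) = 0 := by linarith
    have hA : ip (N p) (A p.1) = -(k₂ * p.2 * ip (N p) (C p.1)) := by
      rw [hγ] at h1; linarith
    conv_lhs => rw [hM.eq_frame_sum hp.1 (N p), hB, hγ, hA]
    module
  have hsq : ∀ p ∈ strip I, ip (N p) (C p.1) ^ 2 = 1 := by
    intro p hp
    obtain ⟨h1, h2, h3, h4, h5, h6, h7, h8, h9, h10, h11, h12, h13, h14, h15, h16⟩ :=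
      hM.ip_table hp.1
    have h := hN.unit p hp
    rw [hform p hp] at h
    generalize ip (N p) (C p.1) = e at h ⊢
    simp only [ip_add_left, ip_smul_left, ip_add_right, ip_smul_right, h3, h4, h15, h16] at h
    linarith
  have hc : ContinuousOn (fun p => ip (N p) (C p.1)) (strip I) :=
    (ContDiffOn.ip hN.smooth (contDiffOn_comp_fst hM.smooth_C)).continuousOn
  have hpre : IsPreconnected (strip I) := hM.interval.isPreconnected.prod isPreconnected_univ
  -- The strip is connected, so the sign cannot change.
  rcases hpre.eq_or_eq_neg_of_sq_eq hc (continuousOn_const (c := (1 : ℝ)))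
    (fun p hp => by simpa using hsq p hp) (fun _ => one_ne_zero) with h | h
  · exact ⟨1, one_pow 2, fun p hp => (hform p hp).trans (congrArg (· • _) (h hp))⟩
  · exact ⟨-1, by norm_num, fun p hp => (hform p hp).trans (congrArg (· • _) (h hp))⟩

theorem isParallelScroll_parallel {N : ℝ × ℝ → E42} {e : ℝ}
    (hN : Set.EqOn N (fun p => e • (C p.1 + (k₂ * p.2) • B p.1)) (strip I)) (u : ℝ) :
    IsParallelScroll γ B C k₂ I (Real.cosh u) (e * Real.sinh u) (parallel (scroll γ B) N u) := by
  intro p hp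
  simp only [parallel, scroll, hN hp]
  module

/-! ### Intervals over which a parallel surface is a single B-scroll -/

/-- A piece of a parallel surface is a B-scroll if the associated Riccati equation has small
coefficients. -/
theorem isBScroll_strip_Ioo (hM : IsCartanFrame I γ A B C k₁ k₂) {a b : ℝ}
    (hab : a ^ 2 - b ^ 2 = 1) {x : ℝ × ℝ → E42} (hx : IsParallelScroll γ B C k₂ I a b x)
    (hm : 0 < a + b * k₂) (hn : 0 < k₂ * (b + a * k₂)) {p q r κ : ℝ} (hpq : p < q)
    (hI : Set.Icc p q ⊆ I) (hr : 0 < r) (hκ : ∀ s ∈ Set.Icc p q, |k₁ s| ≤ κ)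
    (h : (|(k₂ ^ 2 - 1) / (2 * (a + b * k₂))| * r ^ 2 + |b| * κ) * (q - p) ≤ r) :
    ∃ k₂' : ℝ, 0 < k₂ * k₂' ∧ IsBScroll x (strip (Set.Ioo p q)) k₂' := by
  obtain ⟨f, hf⟩ := exists_riccati hpq hr (hM.contDiffOn_k₁.continuousOn.mono hI) hκ h
  have hsub : Set.Ioo p q ⊆ I := Set.Ioo_subset_Icc_self.trans hI
  refine ⟨(b + a * k₂) * (a + b * k₂)⁻¹, by rw [← mul_assoc]; exact mul_pos hn (inv_pos.2 hm), ?_⟩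
  exact hM.isBScroll_of_riccati hsub isOpen_Ioo (Set.nonempty_Ioo.2 hpq) Set.ordConnected_Ioo hab
    hm.ne' (by rw [mul_right_comm, mul_comm, div_mul_cancel₀ _ (mul_ne_zero two_ne_zero hm.ne')])
    hf fun s hs => hx ⟨hsub hs.1, trivial⟩

/-- Here `a` and `b` are fixed and the interval is shortened: length at most `1 / (L + 1)` suffices
for the Riccati bound with `r = 1`. -/
theorem exists_isBScroll_nhds (hM : IsCartanFrame I γ A B C k₁ k₂) {a b : ℝ}
    (hab : a ^ 2 - b ^ 2 = 1) {x : ℝ × ℝ → E42} (hx : IsParallelScroll γ B C k₂ I a b x)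
    (hm : 0 < a + b * k₂) (hn : 0 < k₂ * (b + a * k₂)) {s : ℝ} (hs : s ∈ I) :
    ∃ J : Set ℝ, s ∈ J ∧ J ⊆ I ∧ IsOpen J ∧ J.OrdConnected ∧
      ∃ k₂' : ℝ, 0 < k₂ * k₂' ∧ IsBScroll x (strip J) k₂' := by
  obtain ⟨ε, hε, hεI⟩ := Metric.nhds_basis_closedBall.mem_iff.1 (hM.isOpen.mem_nhds hs)
  rw [Real.closedBall_eq_Icc] at hεI
  obtain ⟨κ, hκ⟩ := isCompact_Icc.exists_bound_of_continuousOn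
    (hM.contDiffOn_k₁.continuousOn.mono hεI)
  have hκ0 : 0 ≤ κ := (norm_nonneg _).trans (hκ s ⟨by linarith, by linarith⟩)
  set L := |(k₂ ^ 2 - 1) / (2 * (a + b * k₂))| * 1 ^ 2 + |b| * κ with hL
  have hL0 : 0 ≤ L := by positivity
  set ε' := min ε (1 / (2 * (L + 1))) with hε'
  have hε'0 : 0 < ε' := lt_min hε (by positivity)
  have hsub : Set.Icc (s - ε') (s + ε') ⊆ Set.Icc (s - ε) (s + ε) :=
    Set.Icc_subset_Icc (by linarith [min_le_left ε (1 / (2 * (L + 1)))])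
      (by linarith [min_le_left ε (1 / (2 * (L + 1)))])
  refine ⟨Set.Ioo (s - ε') (s + ε'), ⟨by linarith, by linarith⟩,
    Set.Ioo_subset_Icc_self.trans (hsub.trans hεI), isOpen_Ioo, Set.ordConnected_Ioo, ?_⟩
  refine hM.isBScroll_strip_Ioo hab hx hm hn (by linarith) (hsub.trans hεI) one_pos
    (fun τ hτ => hκ τ (hsub hτ)) ?_
  have h1 : ε' * (2 * (L + 1)) ≤ 1 :=
    (le_div_iff₀ (by positivity)).1 (min_le_right ε (1 / (2 * (L + 1))))
  rw [← hL]
  linarith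

/-- At `u = 0` the two quantities are `1` and `k₂²`. The bound `1 / 2` keeps the Riccati coefficient
`c` bounded uniformly in `u`. -/
theorem eventually_parallel_regular (hk₂ : k₂ ≠ 0) (e : ℝ) :
    ∀ᶠ u in nhds (0 : ℝ), 1 / 2 < Real.cosh u + e * Real.sinh u * k₂ ∧
      0 < k₂ * (e * Real.sinh u + Real.cosh u * k₂) := by
  have h₁ : Continuous fun u => Real.cosh u + e * Real.sinh u * k₂ := by fun_prop
  have h₂ : Continuous fun u => k₂ * (e * Real.sinh u + Real.cosh u * k₂) := by fun_prop
  refine Filter.Eventually.and (h₁.continuousAt.eventually_const_lt ?_)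
    (h₂.continuousAt.eventually_const_lt ?_)
  · norm_num
  · simpa using mul_self_pos.2 hk₂

theorem cosh_sq_sub_mul_sinh_sq {e : ℝ} (he : e ^ 2 = 1) (u : ℝ) :
    Real.cosh u ^ 2 - (e * Real.sinh u) ^ 2 = 1 := by
  rw [mul_pow, he, one_mul, Real.cosh_sq_sub_sinh_sq]

theorem exists_Icc_subset_of_isCompact {I K : Set ℝ} (hI : IsOpen I) (hI₀ : I.Nonempty)
    (hI' : I.OrdConnected) (hK : IsCompact K) (hKI : K ⊆ I) :
    ∃ p q : ℝ, p < q ∧ K ⊆ Set.Ioo p q ∧ Set.Icc p q ⊆ I := by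
  obtain ⟨s, hs⟩ := hI₀
  -- The extra point covers the case of empty `K`.
  have hK' : IsCompact (insert s K) := hK.insert s
  have hK'I : insert s K ⊆ I := Set.insert_subset hs hKI
  obtain ⟨p, hp, hpK⟩ := hK'.exists_isLeast ⟨s, Set.mem_insert s K⟩
  obtain ⟨q, hq, hqK⟩ := hK'.exists_isGreatest ⟨s, Set.mem_insert s K⟩
  obtain ⟨p', hp', hpI⟩ : ∃ p' < p, p' ∈ I := by
    obtain ⟨l, hl, h⟩ := mem_nhdsLE_iff_exists_Ioc_subset.1
      (mem_nhdsWithin_of_mem_nhds (hI.mem_nhds (hK'I hp)))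
    exact ⟨(l + p) / 2, by linarith [Set.mem_Iio.1 hl], h ⟨by linarith [Set.mem_Iio.1 hl],
      by linarith [Set.mem_Iio.1 hl]⟩⟩
  obtain ⟨q', hq', hqI⟩ : ∃ q' > q, q' ∈ I := by
    obtain ⟨l, hl, h⟩ := mem_nhdsGE_iff_exists_Ico_subset.1
      (mem_nhdsWithin_of_mem_nhds (hI.mem_nhds (hK'I hq)))
    exact ⟨(l + q) / 2, by linarith [Set.mem_Ioi.1 hl], h ⟨by linarith [Set.mem_Ioi.1 hl],
      by linarith [Set.mem_Ioi.1 hl]⟩⟩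
  have hpq : p ≤ q := hpK hq
  refine ⟨p', q', by linarith, fun r hr => ?_, hI'.out hpI hqI⟩
  exact ⟨hp'.trans_le (hpK (Set.mem_insert_of_mem s hr)),
    (hqK (Set.mem_insert_of_mem s hr)).trans_lt hq'⟩

/-- Here the interval is fixed and `u` is shrunk. First `r` is taken so small that the quadratic
term uses at most half of the bound `r`; then `b = e sinh u` is made small enough for the forcing
term to fit into the other half. -/
theorem exists_isBScroll_compact (hM : IsCartanFrame I γ A B C k₁ k₂) (hk₂ : k₂ ≠ 0) {e : ℝ}
    (he : e ^ 2 = 1) {x : ℝ → ℝ × ℝ → E42}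
    (hx : ∀ u, IsParallelScroll γ B C k₂ I (Real.cosh u) (e * Real.sinh u) (x u))
    {K : Set ℝ} (hK : IsCompact K) (hKI : K ⊆ I) :
    ∃ ε : ℝ, 0 < ε ∧ ∀ u : ℝ, |u| < ε →
      ∃ J : Set ℝ, K ⊆ J ∧ J ⊆ I ∧ IsOpen J ∧ J.OrdConnected ∧
        ∃ k₂' : ℝ, 0 < k₂ * k₂' ∧ IsBScroll (x u) (strip J) k₂' := by
  obtain ⟨p, q, hpq, hKpq, hpqI⟩ :=
    exists_Icc_subset_of_isCompact hM.isOpen hM.nonempty hM.interval hK hKI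
  obtain ⟨κ, hκ⟩ := isCompact_Icc.exists_bound_of_continuousOn
    (hM.contDiffOn_k₁.continuousOn.mono hpqI)
  set M := |k₂ ^ 2 - 1| with hM_def
  have hM0 : 0 ≤ M := abs_nonneg _
  have hT : 0 < q - p := sub_pos.2 hpq
  obtain ⟨r, hr, hr'⟩ : ∃ r : ℝ, 0 < r ∧ M * r * (q - p) ≤ 1 / 2 := by
    refine ⟨1 / (2 * (M * (q - p) + 1)), by positivity, ?_⟩
    rw [mul_one_div, div_mul_eq_mul_div, div_le_div_iff₀ (by positivity) two_pos]
    linarith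
  have hsmall : ∀ᶠ u in nhds (0 : ℝ), |e * Real.sinh u| * κ * (q - p) < r / 2 := by
    have h : Continuous fun u => |e * Real.sinh u| * κ * (q - p) := by fun_prop
    refine h.continuousAt.eventually_lt_const ?_
    simpa using hr
  obtain ⟨ε, hε, h⟩ := Metric.eventually_nhds_iff.1 ((eventually_parallel_regular hk₂ e).and hsmall)
  refine ⟨ε, hε, fun u hu => ⟨Set.Ioo p q, hKpq, Set.Ioo_subset_Icc_self.trans hpqI, isOpen_Ioo,
    Set.ordConnected_Ioo, ?_⟩⟩
  obtain ⟨⟨hm, hn⟩, hb⟩ := h (y := u) (by simpa using hu)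
  refine hM.isBScroll_strip_Ioo (cosh_sq_sub_mul_sinh_sq he u) (hx u) (by linarith) hn hpq hpqI hr
    hκ ?_
  -- The denominator is at least 1, because `m > 1 / 2`.
  have hc : |(k₂ ^ 2 - 1) / (2 * (Real.cosh u + e * Real.sinh u * k₂))| ≤ M := by
    rw [abs_div, abs_of_pos (show 0 < 2 * (Real.cosh u + e * Real.sinh u * k₂) by linarith)]
    exact div_le_self hM0 (by linarith)
  calc _ ≤ (M * r ^ 2 + |e * Real.sinh u| * κ) * (q - p) := by gcongr
    _ = M * r * (q - p) * r + |e * Real.sinh u| * κ * (q - p) := by ring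
    _ ≤ 1 / 2 * r + r / 2 := by gcongr
    _ = r := by ring

end IsCartanFrame

end AdS

end

/-! ### The main theorem -/

theorem mainTheorem3
    (I : Set ℝ) (γ A B C : ℝ → AdS.E42) (k₁ : ℝ → ℝ) (k₂ : ℝ)
    (hM : AdS.IsCartanFrame I γ A B C k₁ k₂) (hk₂ : k₂ ≠ 0)
    -- `x` on `AdS.strip I` is the B-scroll over `γ`, with unit normal field `N`
    (x N : ℝ × ℝ → AdS.E42) (hx : x = AdS.scroll γ B)
    (hN : AdS.IsUnitNormal x N (AdS.strip I)) :
    (∃ δ : ℝ, 0 < δ ∧ ∀ u : ℝ, |u| < δ →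
      -- the parallel surface is a Lorentzian surface
      AdS.IsLorentzSurface (AdS.parallel x N u) (AdS.strip I) ∧
      -- it is a B-scroll around each of its rulings
      (∀ s ∈ I, ∃ J : Set ℝ, s ∈ J ∧ J ⊆ I ∧ IsOpen J ∧ J.OrdConnected ∧
        ∃ k₂' : ℝ, 0 < k₂ * k₂' ∧ AdS.IsBScroll (AdS.parallel x N u) (AdS.strip J) k₂') ∧
      -- it is flat exactly when the original surface is
      (AdS.IsFlat (AdS.parallel x N u) (AdS.strip I) ↔ AdS.IsFlat x (AdS.strip I)) ∧
      -- the type of the pseudo-hyperbolic Gauss map is that of the original surface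
      AdS.gaussTypeNumber (AdS.parallel x N u) (AdS.strip I)
        = AdS.gaussTypeNumber x (AdS.strip I) ∧
      (∀ k : ℕ,
        (AdS.GaussIsKType (AdS.parallel x N u) (AdS.strip I) k
          ↔ AdS.GaussIsKType x (AdS.strip I) k) ∧
        (AdS.GaussIsNullKType (AdS.parallel x N u) (AdS.strip I) k
          ↔ AdS.GaussIsNullKType x (AdS.strip I) k))) ∧
    -- over each compact part of the base curve it is a single B-scroll, for `u` close to `0`
    (∀ K : Set ℝ, IsCompact K → K ⊆ I → ∃ ε : ℝ, 0 < ε ∧ ∀ u : ℝ, |u| < ε →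
      ∃ J : Set ℝ, K ⊆ J ∧ J ⊆ I ∧ IsOpen J ∧ J.OrdConnected ∧
        ∃ k₂' : ℝ, 0 < k₂ * k₂' ∧ AdS.IsBScroll (AdS.parallel x N u) (AdS.strip J) k₂') := by
  subst hx
  obtain ⟨e, he, hNe⟩ := hM.exists_normal_eq hN
  have hpar := AdS.IsCartanFrame.isParallelScroll_parallel (γ := γ) hNe
  have hscroll := AdS.IsCartanFrame.isParallelScroll_scroll γ B C k₂ I
  have h1 : (1 : ℝ) + 0 * k₂ ≠ 0 := by simp
  have h2 : (0 : ℝ) + 1 * k₂ ≠ 0 := by simpa using hk₂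
  refine ⟨?_, fun K hK hKI => hM.exists_isBScroll_compact hk₂ he hpar hK hKI⟩
  -- This `δ` depends only on `k₂` and the sign `e`; no bound on `k₁` over `I` enters, since the
  -- intervals may shrink with `s` and `u`.
  obtain ⟨δ, hδ, h⟩ := Metric.eventually_nhds_iff.1
    (AdS.IsCartanFrame.eventually_parallel_regular hk₂ e)
  refine ⟨δ, hδ, fun u hu => ?_⟩
  obtain ⟨hm, hn⟩ := h (y := u) (by simpa using hu)
  have hm0 : 0 < Real.cosh u + e * Real.sinh u * k₂ := by linarith
  have hab := AdS.IsCartanFrame.cosh_sq_sub_mul_sinh_sq he u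
  have hn0 : e * Real.sinh u + Real.cosh u * k₂ ≠ 0 := right_ne_zero_of_mul hn.ne'
  have htype : ∀ k : ℕ,
      (AdS.GaussIsKType (AdS.parallel (AdS.scroll γ B) N u) (AdS.strip I) k
        ↔ AdS.GaussIsKType (AdS.scroll γ B) (AdS.strip I) k) ∧
      (AdS.GaussIsNullKType (AdS.parallel (AdS.scroll γ B) N u) (AdS.strip I) k
        ↔ AdS.GaussIsNullKType (AdS.scroll γ B) (AdS.strip I) k) := fun k =>
    ⟨(hM.gaussIsKType_iff (hpar u) hm0.ne' hn0 k).1.trans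
        (hM.gaussIsKType_iff hscroll h1 h2 k).1.symm,
      (hM.gaussIsKType_iff (hpar u) hm0.ne' hn0 k).2.trans
        (hM.gaussIsKType_iff hscroll h1 h2 k).2.symm⟩
  refine ⟨hM.isLorentzSurface_parallelScroll hab (hpar u) hm0.ne',
    fun s hs => hM.exists_isBScroll_nhds hab (hpar u) hm0 hn hs,
    (hM.isFlat_parallelScroll_iff (hpar u) hm0.ne').trans
      (hM.isFlat_parallelScroll_iff hscroll h1).symm, ?_, htype⟩
  exact iInf_congr fun k => iInf_congr_Prop (htype k).1 fun _ => rfl
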